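/- Let $a\ge b>0$ and $r>0$. Let $C_0$ be a circle of radius $r$ with fixed centre in the Euclidean plane, and $K_0$ the closed disk it bounds. Let $C_1^*$ be a moving ellipse with semi-axes $a$ and $b$, whose axes have fixed directions, and which can only be translated; let $M_1$ be its centre and $K_1^*$ the closed region it bounds. Denote by $\#(C_0\cap C_1^*)$ the number of (real) intersection points, each counted with its intersection multiplicity, by $A(S)$ the area of a set $S$ of points in the plane, and put \[ A_{\mathrm i}^{01}=A(\{M_1\colon C_0\subset K_1^*\}),\qquad A_{\mathrm i}^{10}=A(\{M_1\colon C_1^*\subset K_0\}),\qquad A_{2j}=A(\{M_1\colon \#(C_0\cap C_1^*)=2j\})\quad(j=1,2). \] Let $\varepsilon=\sqrt{a^2-b^2}/a$, let $E(\phi,\varepsilon)=\int_0^\phi\sqrt{1-\varepsilon^2\sin^2\theta}\,d\theta$ and $E(\varepsilon)=E(\pi/2,\varepsilon)$ be the incomplete and the complete elliptic integral of the second kind, and let \[ F(\phi)=2r^2\phi+2ab\arctan\Big(\frac ba\tan\phi\Big)-4raE(\phi,\varepsilon)+\frac{ra\varepsilon^2\sin2\phi}{\sqrt{1-\varepsilon^2\sin^2\phi}},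 \] \[ A^*=\pi r^2+\pi ab-4raE(\varepsilon),\qquad \widetilde F(\phi)=A^*-F(\phi), \] \[ \alpha=\arctan\frac{\sqrt{r^2a^2-b^4}}{b\sqrt{b^2-r^2}},\qquad \beta=\arctan\frac{a\sqrt{r^2-a^2}}{\sqrt{a^4-r^2b^2}}. \] Then $A^*=F(\pi/2)$, where $F(\pi/2)$ is understood as $\lim_{\phi\to\pi/2^-}F(\phi)$. Moreover, the four sets of positions of $M_1$ above are Lebesgue measurable, and their areas are finite and given as follows. 1. If $0<r\le b^2/a$, then $A_{\mathrm i}^{01}=A^*$, $A_{\mathrm i}^{10}=0$, $A_2=8raE(\varepsilon)$, $A_4=0$. 2. If $b^2/a<r<b$, then $A_{\mathrm i}^{01}=\widetilde F(\alpha)$, $A_{\mathrm i}^{10}=0$, $A_2=2\pi r^2+2\pi ab-2\widetilde F(\alpha)$, $A_4=\widetilde F(\alpha)-A^*$. 3. If $b\le r\le a$, then $A_{\mathrm i}^{01}=0$, $A_{\mathrm i}^{10}=0$, $A_2=2\pi r^2+2\pi ab$, $A_4=-A^*$. 4. If $a<r<a^2/b$, then $A_{\mathrm i}^{01}=0$,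 $A_{\mathrm i}^{10}=F(\beta)$, $A_2=2\pi r^2+2\pi ab-2F(\beta)$, $A_4=F(\beta)-A^*$. 5. If $r\ge a^2/b$, then $A_{\mathrm i}^{01}=0$, $A_{\mathrm i}^{10}=A^*$, $A_2=8raE(\varepsilon)$, $A_4=0$. -/

import Mathlib

open Set Filter Topology MeasureTheory

noncomputable section

namespace EllipseCircle

/-- The Euclidean plane. -/
abbrev Plane : Type := EuclideanSpace ℝ (Fin 2)

/-- Unit vector in the direction of angle `ψ`. -/
def axisDir (ψ : ℝ) : Plane := !₂[Real.cos ψ, Real.sin ψ]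

/-- Unit vector obtained from `axisDir ψ` by a quarter turn. -/
def axisNormal (ψ : ℝ) : Plane := !₂[-Real.sin ψ, Real.cos ψ]

/-- The value at `x` of the quadratic form `ξ² / a² + η² / b²`, where `(ξ, η)` are the coordinates
of `x` in the orthonormal frame with origin `m` whose first axis has direction angle `ψ`. -/
def ellipseForm (a b ψ : ℝ) (m x : Plane) : ℝ :=
  (inner ℝ (axisDir ψ) (x - m) / a) ^ 2 + (inner ℝ (axisNormal ψ) (x - m) / b) ^ 2

/-- The ellipse (a curve) with centre `m`, semi-axis `a` in the direction of angle `ψ` and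
semi-axis `b` in the orthogonal direction. -/
def ellipse (a b ψ : ℝ) (m : Plane) : Set Plane := {x | ellipseForm a b ψ m x = 1}

/-- The closed region bounded by the ellipse. -/
def ellipseRegion (a b ψ : ℝ) (m : Plane) : Set Plane := {x | ellipseForm a b ψ m x ≤ 1}

/-- The standard (regular) parametrization of the ellipse. -/
def ellipsePoint (a b ψ : ℝ) (m : Plane) (t : ℝ) : Plane :=
  m + (a * Real.cos t) • axisDir ψ + (b * Real.sin t) • axisNormal ψ

theorem inner_axisDir_ellipsePoint (a b ψ : ℝ) (m : Plane) (t : ℝ) :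
    inner ℝ (axisDir ψ) (ellipsePoint a b ψ m t - m) = a * Real.cos t := by
  simp [ellipsePoint, axisDir, axisNormal, PiLp.inner_apply, Fin.sum_univ_two]
  linear_combination (a * Real.cos t) * Real.sin_sq_add_cos_sq ψ

theorem inner_axisNormal_ellipsePoint (a b ψ : ℝ) (m : Plane) (t : ℝ) :
    inner ℝ (axisNormal ψ) (ellipsePoint a b ψ m t - m) = b * Real.sin t := by
  simp [ellipsePoint, axisDir, axisNormal, PiLp.inner_apply, Fin.sum_univ_two]
  linear_combination (b * Real.sin t) * Real.sin_sq_add_cos_sq ψ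

/-- Every point of the ellipse has exactly one parameter in `[0, 2π)`. -/
theorem bijOn_ellipsePoint {a b : ℝ} (ha : 0 < a) (hb : 0 < b) (ψ : ℝ) (m : Plane) :
    BijOn (ellipsePoint a b ψ m) (Ico 0 (2 * Real.pi)) (ellipse a b ψ m) := by
  refine ⟨fun t _ => ?_, fun s hs t ht h => ?_, fun x hx => ?_⟩
  · simp [ellipse, ellipseForm, inner_axisDir_ellipsePoint, inner_axisNormal_ellipsePoint,
      ha.ne', hb.ne']
  · have h1 := inner_axisDir_ellipsePoint a b ψ m s
    have h2 := inner_axisNormal_ellipsePoint a b ψ m s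
    rw [h, inner_axisDir_ellipsePoint] at h1
    rw [h, inner_axisNormal_ellipsePoint] at h2
    have h3 := mul_left_cancel₀ ha.ne' h1
    have h4 := mul_left_cancel₀ hb.ne' h2
    have h5 := Real.Angle.cos_sin_inj h3.symm h4.symm
    obtain ⟨k, hk⟩ := Real.Angle.angle_eq_iff_two_pi_dvd_sub.1 h5
    have hp := Real.pi_pos
    have k1 : (k : ℝ) < 1 := by
      by_contra! hh
      nlinarith [hs.1, hs.2, ht.1, ht.2]
    have k2 : (-1 : ℝ) < k := by
      by_contra! hh
      nlinarith [hs.1, hs.2, ht.1, ht.2]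
    have k3 : k = 0 := by
      have : k < 1 := by exact_mod_cast k1
      have : -1 < k := by exact_mod_cast k2
      omega
    rw [k3] at hk
    simp at hk
    linarith
  · set u := inner ℝ (axisDir ψ) (x - m) with hu
    set v := inner ℝ (axisNormal ψ) (x - m) with hv
    have h1 : (u / a) ^ 2 + (v / b) ^ 2 = 1 := hx
    let z : ℂ := ⟨u / a, v / b⟩
    have hz : ‖z‖ = 1 := by
      rw [← sq_eq_sq₀ (norm_nonneg _) zero_le_one, Complex.sq_norm, Complex.normSq_apply]
      simp only [z]
      linarith
    have hz0 : z ≠ 0 := fun h => by simp [h] at hz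
    have hc : Real.cos z.arg = u / a := by rw [Complex.cos_arg hz0, hz]; simp [z]
    have hs : Real.sin z.arg = v / b := by rw [Complex.sin_arg, hz]; simp [z]
    have hp := Real.two_pi_pos
    refine ⟨toIcoMod hp 0 z.arg, by simpa using toIcoMod_mem_Ico hp 0 z.arg, ?_⟩
    have e : toIcoMod hp 0 z.arg = z.arg - toIcoDiv hp 0 z.arg * (2 * Real.pi) := by
      rw [toIcoMod, zsmul_eq_mul]
    rw [e, ellipsePoint, Real.cos_sub_int_mul_two_pi, Real.sin_sub_int_mul_two_pi, hc, hs,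
      mul_div_cancel₀ _ ha.ne', mul_div_cancel₀ _ hb.ne', hu, hv]
    ext i
    have sc := Real.sin_sq_add_cos_sq ψ
    fin_cases i
    · simp [axisDir, axisNormal, PiLp.inner_apply, Fin.sum_univ_two]
      linear_combination (x 0 - m 0) * sc
    · simp [axisDir, axisNormal, PiLp.inner_apply, Fin.sum_univ_two]
      linear_combination (x 1 - m 1) * sc

/-- The equation of the circle with centre `c` and radius `r`, pulled back to the ellipse. -/
def pullback (a b ψ r : ℝ) (c m : Plane) (t : ℝ) : ℝ :=
  dist (ellipsePoint a b ψ m t) c ^ 2 - r ^ 2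

theorem analyticAt_pullback (a b ψ r : ℝ) (c m : Plane) (t : ℝ) :
    AnalyticAt ℝ (pullback a b ψ r c m) t := by
  have : pullback a b ψ r c m = fun t =>
      (m 0 + a * Real.cos t * Real.cos ψ - b * Real.sin t * Real.sin ψ - c 0) ^ 2 +
      (m 1 + a * Real.cos t * Real.sin ψ + b * Real.sin t * Real.cos ψ - c 1) ^ 2 - r ^ 2 := by
    funext t
    simp [pullback, ellipsePoint, axisDir, axisNormal, EuclideanSpace.dist_sq_eq,
      Fin.sum_univ_two, Real.dist_eq, sq_abs]
    ring
  rw [this]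
  fun_prop

/-- The intersection multiplicity of the circle with centre `c` and radius `r` and the ellipse at
the point of the ellipse with parameter `t`: the order of vanishing of the equation of the circle
along the ellipse. It is `1` at a transversal intersection, `2` at an ordinary contact, at least
`3` if the circle is the osculating circle, and `⊤` if the curves coincide. -/
def multiplicityAt (a b ψ r : ℝ) (c m : Plane) (t : ℝ) : ℕ∞ :=
  analyticOrderAt (pullback a b ψ r c m) t

/-- Number of intersection points of the circle with centre `c` and radius `r` and the ellipse,
counted with multiplicities (the sum, in `ℕ∞`, of a family of elements of `ℕ∞`, written as the
supremum of its finite partial sums). -/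
def intersectionCount (a b ψ r : ℝ) (c m : Plane) : ℕ∞ :=
  ⨆ s : Finset {t : ℝ // t ∈ Ico 0 (2 * Real.pi) ∧ ellipsePoint a b ψ m t ∈ Metric.sphere c r},
    ∑ t ∈ s, multiplicityAt a b ψ r c m t

/-- `S` is a (Lebesgue) measurable plane set of finite area `x`. -/
def HasArea (S : Set Plane) (x : ℝ) : Prop :=
  NullMeasurableSet S volume ∧ volume S ≠ ⊤ ∧ (volume S).toReal = x

/-- Positions of the centre of the ellipse for which the circle is contained in the closed region
bounded by the ellipse. -/
def circleInside (a b ψ r : ℝ) (c : Plane) : Set Plane :=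
  {m | Metric.sphere c r ⊆ ellipseRegion a b ψ m}

/-- Positions of the centre of the ellipse for which the ellipse is contained in the closed disk. -/
def ellipseInside (a b ψ r : ℝ) (c : Plane) : Set Plane :=
  {m | ellipse a b ψ m ⊆ Metric.closedBall c r}

/-- Positions of the centre of the ellipse for which circle and ellipse have exactly `n`
intersection points, counted with multiplicities. -/
def meetsIn (n : ℕ) (a b ψ r : ℝ) (c : Plane) : Set Plane :=
  {m | intersectionCount a b ψ r c m = n}

/-- Incomplete elliptic integral of the second kind. -/
def ellipticE (φ ε : ℝ) : ℝ := ∫ θ in (0 : ℝ)..φ, Real.sqrt (1 - ε ^ 2 * Real.sin θ ^ 2)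

/-- Complete elliptic integral of the second kind. -/
def completeE (ε : ℝ) : ℝ := ellipticE (Real.pi / 2) ε

/-- Eccentricity. -/
def ecc (a b : ℝ) : ℝ := Real.sqrt (a ^ 2 - b ^ 2) / a

/-- The function `F`; its value at `π / 2` is understood as the limit `Astar`. -/
def F (a b r φ : ℝ) : ℝ :=
  2 * r ^ 2 * φ + 2 * a * b * Real.arctan (b / a * Real.tan φ)
    - 4 * r * a * ellipticE φ (ecc a b)
    + r * a * ecc a b ^ 2 * Real.sin (2 * φ) / Real.sqrt (1 - ecc a b ^ 2 * Real.sin φ ^ 2)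

/-- The constant `A*`. -/
def Astar (a b r : ℝ) : ℝ :=
  Real.pi * r ^ 2 + Real.pi * a * b - 4 * r * a * completeE (ecc a b)

/-- The function `F̃ = A* - F`. -/
def Ftilde (a b r φ : ℝ) : ℝ := Astar a b r - F a b r φ

/-- The angle `α`. -/
def alpha (a b r : ℝ) : ℝ :=
  Real.arctan (Real.sqrt (r ^ 2 * a ^ 2 - b ^ 4) / (b * Real.sqrt (b ^ 2 - r ^ 2)))

/-- The angle `β`. -/
def beta (a b r : ℝ) : ℝ :=
  Real.arctan (a * Real.sqrt (r ^ 2 - a ^ 2) / Real.sqrt (a ^ 4 - r ^ 2 * b ^ 2))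

end EllipseCircle

end

open Set Filter Topology MeasureTheory

noncomputable section

namespace EllipseCircle

/-! ### Area formula with multiplicities -/

/-! Only the position `p` of the centre of the circle relative to the axes of the ellipse matters.
The map `relCoord` from centres of the ellipse to such positions is a reflection in a point followed
by passage to orthonormal coordinates, so it preserves area, and everything can be computed with the
ellipse in normal position.

Inclusion areas. Let h = `supp` be the support function of the ellipse and u the unit vector at
angle θ. The circle lies in the elliptic region iff p·u + r ≤ h(θ) for all θ, and the disk contains
the ellipse iff h(θ) ≤ r + p·u for all θ; if the two regions meet, then p·u ≤ h(θ) + r. Hence all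
three sets of positions are bounded by arcs of parallel curves of the ellipse, with support function
±(h - ρ) and radius of curvature ±(a²b²/h³ - ρ), where ρ = r for the inclusions and ρ = -r for the
Minkowski sum. A quarter of such a set has area ½∫(h - ρ)(a²b²/h³ - ρ)dφ. Since F' = 2(h -
ρ)(a²b²/h³ - ρ) (`hasDerivAt_F`), the full area is a difference of values of F
(`hasCoordArea_of_boundary`). For intermediate radii the parallel curve crosses an axis of the
ellipse, and only the arc beyond or before the crossing bounds the set: α and β are the normal
angles of the crossing.

Intersection numbers. For almost every p all intersections are transversal, and their number is 0, 2
or 4: the half-angle substitution turns them into the simple real roots of a quartic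
(`encard_zeroParams`). Let V₂, V₄ be the areas for the counts 2 and 4, and A the sum of the two
inclusion areas. A nonzero count means that the regions meet without inclusion, so V₂ + V₄ = πr² +
πab + 4raE - A. Poincaré's formula, obtained from the area formula for the map `incidence`, gives
2V₂ + 4V₄ = 16raE (`lintegral_fiberCount`). Solving the two equations (`hasCoordArea_zeroCount`)
yields V₂ and V₄ in each range of r. -/

theorem exists_partition_injOn {E : Type*} [NormedAddCommGroup E] [NormedSpace ℝ E]
    [FiniteDimensional ℝ E] [MeasurableSpace E] [BorelSpace E]
    {f : E → E} {f' : E → E →L[ℝ] E} {D : Set E} (hD : MeasurableSet D)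
    (hf : ∀ x ∈ D, HasStrictFDerivAt f (f' x) x) (hdet : ∀ x ∈ D, (f' x).det ≠ 0) :
    ∃ s : ℕ → Set E, (∀ i, MeasurableSet (s i)) ∧ (∀ i, s i ⊆ D) ∧
      Pairwise (Function.onFun Disjoint s) ∧ (⋃ i, s i) = D ∧ ∀ i, InjOn f (s i) := by
  have : ProperSpace E := FiniteDimensional.proper ℝ E
  rcases D.eq_empty_or_nonempty with rfl | hne
  · exact ⟨fun _ => ∅, by simp, by simp, by intro i j _; simp [Function.onFun], by simp, by simp⟩
  -- The inverse function theorem gives neighbourhoods on which `f` is injective. Countably many of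
  -- them cover `D` by the Lindelöf property, and disjointing these gives the partition.
  have key : ∀ x, ∃ U : Set E, x ∈ D → IsOpen U ∧ x ∈ U ∧ InjOn f U := by
    intro x
    by_cases hx : x ∈ D
    · have h : HasStrictFDerivAt f
          ((f' x).toContinuousLinearEquivOfDetNeZero (hdet x hx) : E →L[ℝ] E) x := hf x hx
      exact ⟨(h.toOpenPartialHomeomorph f).source, fun _ =>
        ⟨(h.toOpenPartialHomeomorph f).open_source, h.mem_toOpenPartialHomeomorph_source,
          (h.toOpenPartialHomeomorph f).injOn⟩⟩
    · exact ⟨∅, fun h => absurd h hx⟩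
  choose U hU using key
  obtain ⟨t, htD, htc, hcov⟩ := TopologicalSpace.countable_cover_nhdsWithin (s := D) (f := U)
    (fun x hx => mem_nhdsWithin_of_mem_nhds ((hU x hx).1.mem_nhds (hU x hx).2.1))
  have htne : t.Nonempty := by
    obtain ⟨x, hx⟩ := hne
    obtain ⟨y, hy, -⟩ := mem_iUnion₂.1 (hcov hx)
    exact ⟨y, hy⟩
  obtain ⟨e, rfl⟩ := htc.exists_eq_range htne
  have he : ∀ i, e i ∈ D := fun i => htD (mem_range_self i)
  refine ⟨disjointed fun i => D ∩ U (e i), fun i => ?_, fun i => ?_, disjoint_disjointed _, ?_,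
    fun i => ?_⟩
  · exact MeasurableSet.disjointed (fun j => hD.inter (hU _ (he j)).1.measurableSet) i
  · exact (disjointed_subset _ i).trans inter_subset_left
  · rw [iUnion_disjointed, ← inter_iUnion]
    refine inter_eq_left.2 (hcov.trans ?_)
    simp
  · exact (hU _ (he i)).2.2.mono ((disjointed_subset _ i).trans inter_subset_right)

/-- On each piece of a partition into injective parts this is the change of variables formula. The
indicators of the images of the pieces add up to the number of points of the fibre. -/
theorem lintegral_abs_det_eq_lintegral_count {E : Type*} [NormedAddCommGroup E] [NormedSpace ℝ E]
    [FiniteDimensional ℝ E] [MeasurableSpace E] [BorelSpace E] (μ : Measure E)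
    [μ.IsAddHaarMeasure] {f : E → E} {f' : E → E →L[ℝ] E} {D : Set E} (hD : MeasurableSet D)
    (hf : ∀ x ∈ D, HasStrictFDerivAt f (f' x) x) (hdet : ∀ x ∈ D, (f' x).det ≠ 0) :
    Measurable (fun y => Measure.count (D ∩ f ⁻¹' {y})) ∧
      ∫⁻ x in D, ENNReal.ofReal |(f' x).det| ∂μ = ∫⁻ y, Measure.count (D ∩ f ⁻¹' {y}) ∂μ := by
  obtain ⟨s, hs, hsD, hdisj, hun, hinj⟩ := exists_partition_injOn hD hf hdet
  have hder : ∀ i, ∀ x ∈ s i, HasFDerivWithinAt f (f' x) (s i) x := fun i x hx =>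
    (hf x (hsD i hx)).hasFDerivAt.hasFDerivWithinAt
  have him : ∀ i, MeasurableSet (f '' s i) := fun i =>
    measurable_image_of_fderivWithin (hs i) (hder i) (hinj i)
  have hcount : (fun y => Measure.count (D ∩ f ⁻¹' {y})) =
      fun y => ∑' i, (f '' s i).indicator 1 y := by
    funext y
    have hsub : ∀ i, (s i ∩ f ⁻¹' {y}).Subsingleton := fun i x hx z hz =>
      hinj i hx.1 hz.1 (hx.2.trans hz.2.symm)
    rw [← hun, iUnion_inter, measure_iUnion
      (fun i j hij => (hdisj hij).mono inter_subset_left inter_subset_left)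
      (fun i => (hsub i).measurableSet)]
    congr 1
    funext i
    by_cases hy : y ∈ f '' s i
    · obtain ⟨x, hx, rfl⟩ := hy
      have : s i ∩ f ⁻¹' {f x} = {x} := (hsub i).eq_singleton_of_mem ⟨hx, rfl⟩
      rw [this, Measure.count_singleton, indicator_of_mem (mem_image_of_mem f hx)]
      rfl
    · have : s i ∩ f ⁻¹' {y} = ∅ := by
        ext x
        simp only [mem_inter_iff, mem_preimage, mem_singleton_iff, mem_empty_iff_false, iff_false]
        exact fun h => hy ⟨x, h.1, h.2⟩
      rw [this, indicator_of_notMem hy, measure_empty]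
  have hmeas : ∀ i, Measurable ((f '' s i).indicator (1 : E → ENNReal)) := fun i =>
    measurable_one.indicator (him i)
  rw [hcount]
  refine ⟨Measurable.tsum hmeas, ?_⟩
  rw [lintegral_tsum fun i => (hmeas i).aemeasurable, ← hun, lintegral_iUnion hs hdisj]
  congr 1
  funext i
  rw [lintegral_abs_det_fderiv_eq_addHaar_image μ (hs i) (hder i) (hinj i),
    lintegral_indicator_one (him i)]

/-! ### Linear maps of the coordinate plane given by their matrix -/

/-- The linear map of the coordinate plane with matrix rows `(p, q)` and `(r, s)`. -/
def matrixMap (p q r s : ℝ) : ℝ × ℝ →L[ℝ] ℝ × ℝ :=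
  (Matrix.toLin (.finTwoProd ℝ) (.finTwoProd ℝ) !![p, q; r, s]).toContinuousLinearMap

theorem det_matrixMap (p q r s : ℝ) : (matrixMap p q r s).det = p * s - q * r := by
  simp only [matrixMap, LinearMap.det_toContinuousLinearMap, LinearMap.det_toLin,
    Matrix.det_fin_two_of]

theorem matrixMap_eq_prod (p q r s : ℝ) : matrixMap p q r s =
    (p • ContinuousLinearMap.fst ℝ ℝ ℝ + q • ContinuousLinearMap.snd ℝ ℝ ℝ).prod
      (r • ContinuousLinearMap.fst ℝ ℝ ℝ + s • ContinuousLinearMap.snd ℝ ℝ ℝ) := by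
  rw [matrixMap, Matrix.toLin_finTwoProd_toContinuousLinearMap]

/-! ### Area of a region swept by a convex arc -/

/-- The part of the set in the open quadrant is swept once by the segments from the origin to the
arc (x, y), whose normal angle is φ. The map (l, φ) ↦ l(x, y) has Jacobian l·k·w, with k the support
function of the arc and w its radius of curvature; integrating l over (0, 1] gives the factor ½. -/
theorem measurableSet_volume_sector {φ₀ φ₁ : ℝ} {x y w : ℝ → ℝ} (h0 : 0 ≤ φ₀) (h01 : φ₀ < φ₁)
    (h1 : φ₁ ≤ Real.pi / 2)
    (hx : ∀ φ, HasDerivAt x (-(Real.sin φ * w φ)) φ)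
    (hy : ∀ φ, HasDerivAt y (Real.cos φ * w φ) φ)
    (hw : ∀ φ ∈ Ioo φ₀ φ₁, 0 < w φ)
    (hx0 : 0 < x φ₀) (hy0 : y φ₀ = 0) (hx1 : x φ₁ = 0) (hy1 : 0 < y φ₁)
    {S : Set (ℝ × ℝ)}
    (hS1 : ∀ φ ∈ Ioo φ₀ φ₁, ∀ l ∈ Ioc (0 : ℝ) 1, (l * x φ, l * y φ) ∈ S)
    (hS2 : ∀ p ∈ S, 0 < p.1 → 0 < p.2 → ∀ φ ∈ Ioo φ₀ φ₁,
      p.1 * Real.cos φ + p.2 * Real.sin φ ≤ x φ * Real.cos φ + y φ * Real.sin φ) :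
    MeasurableSet (S ∩ Ioi 0 ×ˢ Ioi 0) ∧
    volume (S ∩ Ioi 0 ×ˢ Ioi 0) = ∫⁻ φ in Ioo φ₀ φ₁,
      ENNReal.ofReal ((x φ * Real.cos φ + y φ * Real.sin φ) * w φ / 2) := by
  have hxc : Continuous x := continuous_iff_continuousAt.2 fun φ => (hx φ).continuousAt
  have hyc : Continuous y := continuous_iff_continuousAt.2 fun φ => (hy φ).continuousAt
  have hsin : ∀ φ ∈ Ioo φ₀ φ₁, 0 < Real.sin φ := fun φ hφ =>
    Real.sin_pos_of_pos_of_lt_pi (by linarith [hφ.1]) (by linarith [hφ.2, Real.pi_pos])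
  have hcos : ∀ φ ∈ Ioo φ₀ φ₁, 0 < Real.cos φ := fun φ hφ =>
    Real.cos_pos_of_mem_Ioo ⟨by linarith [hφ.1, Real.pi_pos], by linarith [hφ.2]⟩
  have hxanti : StrictAntiOn x (Icc φ₀ φ₁) := by
    refine strictAntiOn_of_deriv_neg (convex_Icc _ _) hxc.continuousOn fun φ hφ => ?_
    rw [interior_Icc] at hφ
    rw [(hx φ).deriv]
    have := mul_pos (hsin φ hφ) (hw φ hφ)
    linarith
  have hymono : StrictMonoOn y (Icc φ₀ φ₁) := by
    refine strictMonoOn_of_deriv_pos (convex_Icc _ _) hyc.continuousOn fun φ hφ => ?_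
    rw [interior_Icc] at hφ
    rw [(hy φ).deriv]
    exact mul_pos (hcos φ hφ) (hw φ hφ)
  have hxpos : ∀ φ ∈ Ioo φ₀ φ₁, 0 < x φ := fun φ hφ => by
    rw [← hx1]
    exact hxanti (Ioo_subset_Icc_self hφ) (right_mem_Icc.2 h01.le) hφ.2
  have hypos : ∀ φ ∈ Ioo φ₀ φ₁, 0 < y φ := fun φ hφ => by
    rw [← hy0]
    exact hymono (left_mem_Icc.2 h01.le) (Ioo_subset_Icc_self hφ) hφ.1
  set f : ℝ × ℝ → ℝ × ℝ := fun z => (z.1 * x z.2, z.1 * y z.2) with hf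
  set f' : ℝ × ℝ → ℝ × ℝ →L[ℝ] ℝ × ℝ := fun z => matrixMap (x z.2)
    (z.1 * -(Real.sin z.2 * w z.2)) (y z.2) (z.1 * (Real.cos z.2 * w z.2)) with hf'
  set D : Set (ℝ × ℝ) := Ioc 0 1 ×ˢ Ioo φ₀ φ₁ with hDdef
  have hD : MeasurableSet D := measurableSet_Ioc.prod measurableSet_Ioo
  have hder : ∀ z ∈ D, HasFDerivWithinAt f (f' z) D z := by
    intro z _
    refine HasFDerivAt.hasFDerivWithinAt ?_
    simp only [hf', matrixMap_eq_prod]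
    refine HasFDerivAt.prodMk ?_ ?_
    · refine (hasFDerivAt_fst.mul ((hx z.2).comp_hasFDerivAt z hasFDerivAt_snd)).congr_fderiv ?_
      ext <;> simp
    · refine (hasFDerivAt_fst.mul ((hy z.2).comp_hasFDerivAt z hasFDerivAt_snd)).congr_fderiv ?_
      ext <;> simp
  -- If φ < φ' gave the same image, the decrease of x would force l < l', and the increase of y
  -- would then make the second coordinates different.
  have hlt : ∀ z ∈ D, ∀ z' ∈ D, f z = f z' → ¬ z.2 < z'.2 := by
    rintro ⟨l, φ⟩ ⟨hl, hφ⟩ ⟨l', φ'⟩ ⟨hl', hφ'⟩ he hlt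
    simp only [hf, Prod.mk.injEq] at he hlt
    have e1 := hxanti (Ioo_subset_Icc_self hφ) (Ioo_subset_Icc_self hφ') hlt
    have e2 := hymono (Ioo_subset_Icc_self hφ) (Ioo_subset_Icc_self hφ') hlt
    have p1 := hxpos _ hφ'
    have p2 := hypos _ hφ
    simp only [mem_Ioc] at hl hl' e1 e2 p1 p2
    have q1 : l < l' := by
      by_contra! hh
      nlinarith [mul_lt_mul_of_pos_left e1 hl.1]
    nlinarith [mul_lt_mul_of_pos_left e2 hl.1]
  have hinj : InjOn f D := by
    rintro ⟨l, φ⟩ hz ⟨l', φ'⟩ hz' he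
    have e : φ = φ' := le_antisymm (not_lt.1 (hlt _ hz' _ hz he.symm)) (not_lt.1 (hlt _ hz _ hz' he))
    subst e
    simp only [hf, Prod.mk.injEq] at he
    rw [mul_right_cancel₀ (hxpos _ hz.2).ne' he.1]
  have himage : f '' D = S ∩ Ioi 0 ×ˢ Ioi 0 := by
    apply Subset.antisymm
    · rintro _ ⟨⟨l, φ⟩, ⟨hl, hφ⟩, rfl⟩
      exact ⟨hS1 φ hφ l hl, mul_pos hl.1 (hxpos φ hφ), mul_pos hl.1 (hypos φ hφ)⟩
    · rintro ⟨p, q⟩ ⟨hpS, hp, hq⟩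
      simp only [mem_Ioi] at hp hq
      -- This φ is the parameter at which the ray through (p, q) meets the arc. The support
      -- inequality at φ then bounds the dilation factor by 1.
      obtain ⟨φ, hφ, hz⟩ : ∃ φ ∈ Ioo φ₀ φ₁, x φ * q - y φ * p = 0 := by
        have := intermediate_value_Ioo' (f := fun φ => x φ * q - y φ * p) h01.le
          (by fun_prop) (show (0 : ℝ) ∈ _ from ⟨by rw [hx1]; nlinarith, by rw [hy0]; nlinarith⟩)
        obtain ⟨φ, hφ, h⟩ := this
        exact ⟨φ, hφ, h⟩
      have hX := hxpos φ hφ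
      have hY := hypos φ hφ
      have hl0 : 0 < p / x φ := div_pos hp hX
      have e1 : p / x φ * x φ = p := div_mul_cancel₀ _ hX.ne'
      have e2 : p / x φ * y φ = q := by
        field_simp
        linarith
      refine ⟨(p / x φ, φ), ⟨⟨hl0, ?_⟩, hφ⟩, by simp only [hf, e1, e2]⟩
      have h3 := hS2 _ hpS hp hq φ hφ
      simp only at h3
      have hk : 0 < x φ * Real.cos φ + y φ * Real.sin φ :=
        add_pos (mul_pos hX (hcos φ hφ)) (mul_pos hY (hsin φ hφ))
      by_contra! hh
      have : p * Real.cos φ + q * Real.sin φ =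
          p / x φ * (x φ * Real.cos φ + y φ * Real.sin φ) := by
        rw [mul_add, ← mul_assoc, ← mul_assoc, e1, e2]
      nlinarith
  rw [← himage]
  refine ⟨measurable_image_of_fderivWithin hD hder hinj, ?_⟩
  rw [← lintegral_abs_det_fderiv_eq_addHaar_image volume hD hder hinj]
  have hdet : ∀ z ∈ D, ENNReal.ofReal |(f' z).det| = ENNReal.ofReal z.1 *
      ENNReal.ofReal ((x z.2 * Real.cos z.2 + y z.2 * Real.sin z.2) * w z.2) := by
    rintro ⟨l, φ⟩ ⟨hl, hφ⟩
    have hX := hxpos φ hφ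
    have hY := hypos φ hφ
    have hk : 0 < (x φ * Real.cos φ + y φ * Real.sin φ) * w φ :=
        mul_pos (add_pos (mul_pos hX (hcos φ hφ)) (mul_pos hY (hsin φ hφ))) (hw φ hφ)
    rw [← ENNReal.ofReal_mul hl.1.le, hf', det_matrixMap]
    simp only
    rw [show x φ * (l * (Real.cos φ * w φ)) - l * -(Real.sin φ * w φ) * y φ =
      l * ((x φ * Real.cos φ + y φ * Real.sin φ) * w φ) by ring, abs_of_pos (mul_pos hl.1 hk)]
  -- No regularity of `w` is assumed; on the interval it is y' / cos, and a derivative is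
  -- measurable.
  have hwm : AEMeasurable w (volume.restrict (Ioo φ₀ φ₁)) := by
    have : EqOn (fun φ => deriv y φ / Real.cos φ) w (Ioo φ₀ φ₁) := fun φ hφ => by
      simp only
      rw [(hy φ).deriv, mul_div_cancel_left₀ _ (hcos φ hφ).ne']
    refine AEMeasurable.congr
      ((measurable_deriv y).div Real.continuous_cos.measurable).aemeasurable ?_
    exact (ae_restrict_iff' measurableSet_Ioo).2 (Eventually.of_forall this)
  rw [setLIntegral_congr_fun hD hdet, hDdef, Measure.volume_eq_prod, ← Measure.prod_restrict,
    lintegral_prod_mul (f := fun l => ENNReal.ofReal l)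
      (g := fun φ => ENNReal.ofReal ((x φ * Real.cos φ + y φ * Real.sin φ) * w φ))
      (by fun_prop) (by fun_prop)]
  have hhalf : ∫⁻ l in Ioc (0 : ℝ) 1, ENNReal.ofReal l = ENNReal.ofReal (1 / 2) := by
    rw [← ofReal_integral_eq_lintegral_ofReal, ← intervalIntegral.integral_of_le zero_le_one,
      integral_id]
    · norm_num
    · exact (intervalIntegrable_iff_integrableOn_Ioc_of_le zero_le_one).1
        intervalIntegral.intervalIntegrable_id
    · exact (ae_restrict_iff' measurableSet_Ioc).2 (Eventually.of_forall fun l hl => hl.1.le)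
  rw [hhalf, ← lintegral_const_mul' _ _ ENNReal.ofReal_ne_top]
  refine lintegral_congr fun φ => ?_
  rw [← ENNReal.ofReal_mul (by norm_num)]
  congr 1
  ring

/-! ### The support function of the ellipse and the function `F` -/

/-- The support function of the ellipse `x² / a² + y² / b² = 1`. -/
def supp (a b φ : ℝ) : ℝ := Real.sqrt (a ^ 2 * Real.cos φ ^ 2 + b ^ 2 * Real.sin φ ^ 2)

section Supp

variable {a b : ℝ}

theorem supp_sq (a b φ : ℝ) :
    supp a b φ ^ 2 = a ^ 2 * Real.cos φ ^ 2 + b ^ 2 * Real.sin φ ^ 2 :=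
  Real.sq_sqrt (by positivity)

theorem supp_nonneg (a b φ : ℝ) : 0 ≤ supp a b φ := Real.sqrt_nonneg _

theorem le_supp (hb : 0 < b) (hab : b ≤ a) (φ : ℝ) : b ≤ supp a b φ := by
  refine abs_le_of_sq_le_sq' ?_ (supp_nonneg a b φ) |>.2
  rw [supp_sq]
  nlinarith [Real.sin_sq_add_cos_sq φ, sq_nonneg (Real.cos φ), mul_nonneg
    (sub_nonneg.2 (pow_le_pow_left₀ hb.le hab 2)) (sq_nonneg (Real.cos φ))]

theorem supp_pos (hb : 0 < b) (hab : b ≤ a) (φ : ℝ) : 0 < supp a b φ :=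
  hb.trans_le (le_supp hb hab φ)

theorem supp_le (hb : 0 < b) (hab : b ≤ a) (φ : ℝ) : supp a b φ ≤ a := by
  refine abs_le_of_sq_le_sq' ?_ (hb.le.trans hab) |>.2
  rw [supp_sq]
  nlinarith [Real.sin_sq_add_cos_sq φ, mul_nonneg
    (sub_nonneg.2 (pow_le_pow_left₀ hb.le hab 2)) (sq_nonneg (Real.sin φ))]

theorem continuous_supp (a b : ℝ) : Continuous (supp a b) := by
  unfold supp
  fun_prop

theorem hasDerivAt_supp (hb : 0 < b) (hab : b ≤ a) (φ : ℝ) :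
    HasDerivAt (supp a b) (-((a ^ 2 - b ^ 2) * Real.sin φ * Real.cos φ / supp a b φ)) φ := by
  have hpos := supp_pos hb hab φ
  have h1 : HasDerivAt (fun φ => a ^ 2 * Real.cos φ ^ 2 + b ^ 2 * Real.sin φ ^ 2)
      (-(2 * ((a ^ 2 - b ^ 2) * Real.sin φ * Real.cos φ))) φ := by
    refine ((((Real.hasDerivAt_cos φ).pow 2).const_mul (a ^ 2)).add
      (((Real.hasDerivAt_sin φ).pow 2).const_mul (b ^ 2))).congr_deriv ?_
    simp
    ring
  refine (h1.sqrt (by rw [← supp_sq]; positivity)).congr_deriv ?_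
  rw [← supp]
  field_simp

/-- The boundary point with normal angle φ moves in the tangent direction at a speed equal to the
radius of curvature. For the ellipse this radius is h + h'' = a²b²/h³, and passing to the parallel
curve at distance ρ subtracts ρ. -/
theorem hasDerivAt_boundary_fst (hb : 0 < b) (hab : b ≤ a) (σ ρ φ : ℝ) :
    HasDerivAt (fun φ => σ * (Real.cos φ * (a ^ 2 / supp a b φ - ρ)))
      (-(Real.sin φ * (σ * (a ^ 2 * b ^ 2 / supp a b φ ^ 3 - ρ)))) φ := by
  have hpos := supp_pos hb hab φ
  refine ((((Real.hasDerivAt_cos φ).mul ((((hasDerivAt_supp hb hab φ).inv hpos.ne').const_mul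
    (a ^ 2)).sub_const ρ)).const_mul σ).congr_of_eventuallyEq
    (Eventually.of_forall fun x => ?_)).congr_deriv ?_
  · simp [div_eq_mul_inv]
  · have := supp_sq a b φ
    field_simp
    simp only [Pi.inv_apply]
    field_simp
    have e := Real.sin_sq_add_cos_sq φ
    linear_combination (-(σ * Real.sin φ * a ^ 2)) * this - σ * Real.sin φ * a ^ 2 * b ^ 2 * e

theorem hasDerivAt_boundary_snd (hb : 0 < b) (hab : b ≤ a) (σ ρ φ : ℝ) :
    HasDerivAt (fun φ => σ * (Real.sin φ * (b ^ 2 / supp a b φ - ρ)))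
      (Real.cos φ * (σ * (a ^ 2 * b ^ 2 / supp a b φ ^ 3 - ρ))) φ := by
  have hpos := supp_pos hb hab φ
  refine ((((Real.hasDerivAt_sin φ).mul ((((hasDerivAt_supp hb hab φ).inv hpos.ne').const_mul
    (b ^ 2)).sub_const ρ)).const_mul σ).congr_of_eventuallyEq
    (Eventually.of_forall fun x => ?_)).congr_deriv ?_
  · simp [div_eq_mul_inv]
  · have := supp_sq a b φ
    field_simp
    simp only [Pi.inv_apply]
    field_simp
    have e := Real.sin_sq_add_cos_sq φ
    linear_combination (σ * Real.cos φ * b ^ 2) * this + σ * Real.cos φ * a ^ 2 * b ^ 2 * e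

theorem boundary_inner (hb : 0 < b) (hab : b ≤ a) (σ ρ φ : ℝ) :
    σ * (Real.cos φ * (a ^ 2 / supp a b φ - ρ)) * Real.cos φ +
      σ * (Real.sin φ * (b ^ 2 / supp a b φ - ρ)) * Real.sin φ = σ * (supp a b φ - ρ) := by
  have hpos := supp_pos hb hab φ
  have := supp_sq a b φ
  have e := Real.sin_sq_add_cos_sq φ
  field_simp
  linear_combination (-σ) * this - σ * ρ * supp a b φ * e

theorem ecc_sq (hb : 0 < b) (hab : b ≤ a) : ecc a b ^ 2 = (a ^ 2 - b ^ 2) / a ^ 2 := by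
  rw [ecc, div_pow, Real.sq_sqrt (sub_nonneg.2 (pow_le_pow_left₀ hb.le hab 2))]

theorem sqrt_one_sub_ecc (hb : 0 < b) (hab : b ≤ a) (φ : ℝ) :
    Real.sqrt (1 - ecc a b ^ 2 * Real.sin φ ^ 2) = supp a b φ / a := by
  have ha : 0 < a := hb.trans_le hab
  rw [ecc_sq hb hab, Real.sqrt_eq_iff_eq_sq, div_pow, supp_sq]
  · field_simp
    linear_combination (-a ^ 2) * Real.sin_sq_add_cos_sq φ
  · have : 1 - (a ^ 2 - b ^ 2) / a ^ 2 * Real.sin φ ^ 2 = supp a b φ ^ 2 / a ^ 2 := by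
      rw [supp_sq]
      field_simp
      linear_combination (-a ^ 2) * Real.sin_sq_add_cos_sq φ
    rw [this]
    positivity
  · exact div_nonneg (supp_nonneg _ _ _) ha.le

theorem mul_ellipticE (hb : 0 < b) (hab : b ≤ a) (φ : ℝ) :
    a * ellipticE φ (ecc a b) = ∫ θ in (0 : ℝ)..φ, supp a b θ := by
  have ha : 0 < a := hb.trans_le hab
  rw [ellipticE, ← intervalIntegral.integral_const_mul]
  congr 1
  funext θ
  rw [sqrt_one_sub_ecc hb hab, mul_div_cancel₀ _ ha.ne']

theorem F_eq (hb : 0 < b) (hab : b ≤ a) (ρ φ : ℝ) : F a b ρ φ =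
    2 * ρ ^ 2 * φ + 2 * a * b * Real.arctan (b / a * Real.tan φ)
      - 4 * ρ * (∫ θ in (0 : ℝ)..φ, supp a b θ)
      + ρ * (a ^ 2 - b ^ 2) * Real.sin (2 * φ) / supp a b φ := by
  have ha : 0 < a := hb.trans_le hab
  have := supp_pos hb hab φ
  rw [F, sqrt_one_sub_ecc hb hab, ← mul_ellipticE hb hab, ecc_sq hb hab]
  field_simp

theorem Astar_eq (hb : 0 < b) (hab : b ≤ a) (ρ : ℝ) : Astar a b ρ =
    Real.pi * ρ ^ 2 + Real.pi * a * b - 4 * ρ * ∫ θ in (0 : ℝ)..(Real.pi / 2), supp a b θ := by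
  rw [Astar, completeE, ← mul_ellipticE hb hab]
  ring

theorem hasDerivAt_integral_supp (a b φ : ℝ) :
    HasDerivAt (fun φ => ∫ θ in (0 : ℝ)..φ, supp a b θ) (supp a b φ) φ :=
  (continuous_supp a b).integral_hasStrictDerivAt 0 φ |>.hasDerivAt

/-- The derivative is four times the sector integrand ½(h - ρ)(a²b²/h³ - ρ), so increments of `F`
measure the whole symmetric region and not only its quarter. -/
theorem hasDerivAt_F (hb : 0 < b) (hab : b ≤ a) (ρ : ℝ) {φ : ℝ} (hφ : Real.cos φ ≠ 0) :
    HasDerivAt (F a b ρ) (2 * (supp a b φ - ρ) * (a ^ 2 * b ^ 2 / supp a b φ ^ 3 - ρ)) φ := by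
  have ha : 0 < a := hb.trans_le hab
  have hpos := supp_pos hb hab φ
  have h1 : HasDerivAt (fun φ => 2 * ρ ^ 2 * φ) (2 * ρ ^ 2) φ := by
    simpa using (hasDerivAt_id φ).const_mul (2 * ρ ^ 2)
  have h2 : HasDerivAt (fun φ => 2 * a * b * Real.arctan (b / a * Real.tan φ))
      (2 * a ^ 2 * b ^ 2 / supp a b φ ^ 2) φ := by
    refine (((Real.hasDerivAt_tan hφ).const_mul (b / a)).arctan.const_mul
      (2 * a * b)).congr_deriv ?_
    have e : 1 + (b / a * Real.tan φ) ^ 2 = supp a b φ ^ 2 / (a ^ 2 * Real.cos φ ^ 2) := by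
      rw [supp_sq, Real.tan_eq_sin_div_cos]
      field_simp
    rw [e]
    field_simp
  have h3 := (hasDerivAt_integral_supp a b φ).const_mul (4 * ρ)
  have h4 : HasDerivAt (fun φ => ρ * (a ^ 2 - b ^ 2) * Real.sin (2 * φ) / supp a b φ)
      (ρ * (a ^ 2 - b ^ 2) * ((2 * Real.cos (2 * φ)) * supp a b φ - Real.sin (2 * φ) *
        -((a ^ 2 - b ^ 2) * Real.sin φ * Real.cos φ / supp a b φ)) / supp a b φ ^ 2) φ := by
    have h5 : HasDerivAt (fun φ => Real.sin (2 * φ)) (2 * Real.cos (2 * φ)) φ := by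
      refine ((hasDerivAt_id φ).const_mul 2).sin.congr_deriv ?_
      simp
      ring
    refine ((h5.const_mul (ρ * (a ^ 2 - b ^ 2))).div (hasDerivAt_supp hb hab φ)
      hpos.ne').congr_deriv ?_
    ring
  have h := ((h1.add h2).sub h3).add h4
  refine (h.congr_of_eventuallyEq (Eventually.of_forall fun x => ?_)).congr_deriv ?_
  · simp only [Pi.add_apply, Pi.sub_apply]
    exact F_eq hb hab ρ x
  · have hs := supp_sq a b φ
    have e := Real.sin_sq_add_cos_sq φ
    have e' : Real.sin φ ^ 2 = 1 - Real.cos φ ^ 2 := by linarith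
    have hs' : supp a b φ ^ 2 = b ^ 2 + (a ^ 2 - b ^ 2) * Real.cos φ ^ 2 := by
      rw [hs, e']; ring
    have h4' : supp a b φ ^ 4 = (b ^ 2 + (a ^ 2 - b ^ 2) * Real.cos φ ^ 2) ^ 2 := by
      rw [← hs']; ring
    rw [Real.cos_two_mul, Real.sin_two_mul]
    field_simp
    rw [← sub_eq_zero]
    ring_nf
    simp only [h4', hs', e']
    ring

/-- Only the arctangent term needs a limit: `Real.tan` has the default value 0 at π/2, whereas from
the left this term tends to πab. The other terms are continuous. -/
theorem tendsto_F_pi_div_two (hb : 0 < b) (hab : b ≤ a) (ρ : ℝ) :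
    Tendsto (F a b ρ) (𝓝[<] (Real.pi / 2)) (𝓝 (Astar a b ρ)) := by
  have ha : 0 < a := hb.trans_le hab
  have h1 : Tendsto (fun φ => Real.arctan (b / a * Real.tan φ)) (𝓝[<] (Real.pi / 2))
      (𝓝 (Real.pi / 2)) :=
    (Real.tendsto_arctan_atTop.mono_right nhdsWithin_le_nhds).comp
      (Real.tendsto_tan_pi_div_two.const_mul_atTop (div_pos hb ha))
  have h2 : Tendsto (fun φ => 2 * ρ ^ 2 * φ - 4 * ρ * (∫ θ in (0 : ℝ)..φ, supp a b θ)
      + ρ * (a ^ 2 - b ^ 2) * Real.sin (2 * φ) / supp a b φ) (𝓝[<] (Real.pi / 2))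
      (𝓝 (2 * ρ ^ 2 * (Real.pi / 2) - 4 * ρ * (∫ θ in (0 : ℝ)..(Real.pi / 2), supp a b θ)
      + ρ * (a ^ 2 - b ^ 2) * Real.sin (2 * (Real.pi / 2)) / supp a b (Real.pi / 2))) := by
    refine Tendsto.mono_left (ContinuousAt.tendsto ?_) nhdsWithin_le_nhds
    have c1 : Continuous (fun φ => ∫ θ in (0 : ℝ)..φ, supp a b θ) :=
      continuous_iff_continuousAt.2 fun φ => (hasDerivAt_integral_supp a b φ).continuousAt
    have c2 := continuous_supp a b
    have c3 : ∀ φ, supp a b φ ≠ 0 := fun φ => (supp_pos hb hab φ).ne'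
    refine Continuous.continuousAt ?_
    fun_prop (disch := assumption)
  have h3 := h2.add (h1.const_mul (2 * a * b))
  rw [show 2 * (Real.pi / 2) = Real.pi by ring, Real.sin_pi] at h3
  rw [Astar_eq hb hab]
  have e : F a b ρ = fun φ => 2 * ρ ^ 2 * φ - 4 * ρ * (∫ θ in (0 : ℝ)..φ, supp a b θ)
      + ρ * (a ^ 2 - b ^ 2) * Real.sin (2 * φ) / supp a b φ
      + 2 * a * b * Real.arctan (b / a * Real.tan φ) := by
    funext φ
    rw [F_eq hb hab]
    ring
  rw [e]
  convert h3 using 2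
  ring

theorem F_zero (a b ρ : ℝ) : F a b ρ 0 = 0 := by
  simp [F, ellipticE]

theorem tendsto_F_zero (hb : 0 < b) (hab : b ≤ a) (ρ : ℝ) :
    Tendsto (F a b ρ) (𝓝[>] 0) (𝓝 0) := by
  have := (hasDerivAt_F hb hab ρ (φ := 0) (by simp)).continuousAt.tendsto
  rw [F_zero] at this
  exact this.mono_left nhdsWithin_le_nhds

end Supp

/-! ### Areas in the coordinate plane -/

/-- `S` is a (Lebesgue) measurable set of finite area `x` in the coordinate plane. -/
def HasCoordArea (S : Set (ℝ × ℝ)) (x : ℝ) : Prop :=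
  NullMeasurableSet S volume ∧ volume S ≠ ⊤ ∧ (volume S).toReal = x

theorem hasCoordArea_of_null {S : Set (ℝ × ℝ)} (h : volume S = 0) : HasCoordArea S 0 :=
  ⟨NullMeasurableSet.of_null h, by simp [h], by simp [h]⟩

/-- Up to a null set, `S` is the disjoint union of `S ∩ U` and its mirror image. Thus measurability
too is inherited from one half. -/
theorem measure_eq_two_mul_of_symm {α : Type*} [MeasurableSpace α] {μ : Measure α} {τ : α → α}
    (hτ : MeasurePreserving τ μ μ) {S U : Set α}
    (hS : ∀ x ∈ S, τ x ∈ S) (hτ2 : ∀ x, τ (τ x) = x) (hdisj : ∀ x ∈ U, τ x ∉ U)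
    (hae : ∀ᵐ x ∂μ, x ∈ U ∨ τ x ∈ U) (hN : NullMeasurableSet (S ∩ U) μ) :
    NullMeasurableSet S μ ∧ μ S = 2 * μ (S ∩ U) := by
  have hS' : ∀ x, τ x ∈ S ↔ x ∈ S := fun x => ⟨fun h => hτ2 x ▸ hS _ h, hS x⟩
  have h1 : S =ᵐ[μ] (S ∩ U ∪ τ ⁻¹' (S ∩ U) : Set α) := by
    filter_upwards [hae] with x hx
    refine propext ?_
    change x ∈ S ↔ x ∈ S ∩ U ∪ τ ⁻¹' (S ∩ U)
    simp only [mem_union, mem_inter_iff, mem_preimage, hS']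
    tauto
  have hN' : NullMeasurableSet (τ ⁻¹' (S ∩ U)) μ := hN.preimage hτ.quasiMeasurePreserving
  refine ⟨(hN.union hN').congr h1.symm, ?_⟩
  rw [measure_congr h1, measure_union₀ hN', hτ.measure_preimage hN, two_mul]
  refine Disjoint.aedisjoint (disjoint_left.2 fun x hx hx' => hdisj x hx.2 hx'.2)

theorem ae_fst_ne_zero : ∀ᵐ p : ℝ × ℝ, p.1 ≠ 0 := by
  have : volume (({0} : Set ℝ) ×ˢ (univ : Set ℝ)) = 0 := by
    rw [Measure.volume_eq_prod, Measure.prod_prod]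
    simp
  refine measure_mono_null (fun p hp => ?_) this
  simpa using hp

theorem ae_snd_ne_zero : ∀ᵐ p : ℝ × ℝ, p.2 ≠ 0 := by
  have : volume ((univ : Set ℝ) ×ˢ ({0} : Set ℝ)) = 0 := by
    rw [Measure.volume_eq_prod, Measure.prod_prod]
    simp
  refine measure_mono_null (fun p hp => ?_) this
  simpa using hp

theorem volume_eq_four_mul_quadrant {S : Set (ℝ × ℝ)} (h1 : ∀ p ∈ S, (-p.1, p.2) ∈ S)
    (h2 : ∀ p ∈ S, (p.1, -p.2) ∈ S) (hN : NullMeasurableSet (S ∩ Ioi 0 ×ˢ Ioi 0)) :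
    NullMeasurableSet S ∧ volume S = 4 * volume (S ∩ Ioi 0 ×ˢ Ioi 0) := by
  have t1 : MeasurePreserving (fun p : ℝ × ℝ => (-p.1, p.2)) volume volume :=
    (Measure.measurePreserving_neg (volume : Measure ℝ)).prod (MeasurePreserving.id volume)
  have t2 : MeasurePreserving (fun p : ℝ × ℝ => (p.1, -p.2)) volume volume :=
    (MeasurePreserving.id volume).prod (Measure.measurePreserving_neg (volume : Measure ℝ))
  have e : S ∩ Ioi 0 ×ˢ univ ∩ univ ×ˢ Ioi 0 = S ∩ Ioi 0 ×ˢ Ioi 0 := by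
    rw [inter_assoc, prod_inter_prod, univ_inter, inter_univ]
  have A := measure_eq_two_mul_of_symm t2 (S := S ∩ Ioi 0 ×ˢ univ) (U := univ ×ˢ Ioi 0)
    (fun p hp => ⟨h2 p hp.1, hp.2⟩) (by simp)
    (fun p hp hp' => by
      simp only [mem_prod, mem_univ, mem_Ioi, true_and] at hp hp'
      linarith)
    (by
      filter_upwards [ae_snd_ne_zero] with p hp
      simpa [or_comm] using lt_or_gt_of_ne hp)
    (by rwa [e])
  have B := measure_eq_two_mul_of_symm t1 (S := S) (U := Ioi 0 ×ˢ univ)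
    h1 (by simp)
    (fun p hp hp' => by
      simp only [mem_prod, mem_univ, mem_Ioi, and_true] at hp hp'
      linarith)
    (by
      filter_upwards [ae_fst_ne_zero] with p hp
      simpa [or_comm] using lt_or_gt_of_ne hp)
    A.1
  refine ⟨B.1, ?_⟩
  rw [B.2, A.2, e, ← mul_assoc]
  norm_num

/-- The common source of all three areas. The sign σ allows for outer and inner position (σ = 1, ρ =
-r or r) and for a disk containing the ellipse (σ = -1, ρ = r). It occurs squared in the integrand,
which is therefore always F'/4 on a quadrant. -/
theorem hasCoordArea_of_boundary {a b : ℝ} (hb : 0 < b) (hab : b ≤ a) {σ ρ : ℝ}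
    (hσ : σ ^ 2 = 1) {φ₀ φ₁ F₀ F₁ : ℝ} (h0 : 0 ≤ φ₀) (h01 : φ₀ < φ₁) (h1 : φ₁ ≤ Real.pi / 2)
    (hF0 : Tendsto (F a b ρ) (𝓝[>] φ₀) (𝓝 F₀)) (hF1 : Tendsto (F a b ρ) (𝓝[<] φ₁) (𝓝 F₁))
    (hk : ∀ φ ∈ Ioo φ₀ φ₁, 0 ≤ σ * (supp a b φ - ρ))
    (hw : ∀ φ ∈ Ioo φ₀ φ₁, 0 < σ * (a ^ 2 * b ^ 2 / supp a b φ ^ 3 - ρ))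
    (hx0 : 0 < σ * (Real.cos φ₀ * (a ^ 2 / supp a b φ₀ - ρ)))
    (hy0 : σ * (Real.sin φ₀ * (b ^ 2 / supp a b φ₀ - ρ)) = 0)
    (hx1 : σ * (Real.cos φ₁ * (a ^ 2 / supp a b φ₁ - ρ)) = 0)
    (hy1 : 0 < σ * (Real.sin φ₁ * (b ^ 2 / supp a b φ₁ - ρ)))
    {S : Set (ℝ × ℝ)} (hsymm1 : ∀ p ∈ S, (-p.1, p.2) ∈ S) (hsymm2 : ∀ p ∈ S, (p.1, -p.2) ∈ S)
    (hS1 : ∀ φ ∈ Ioo φ₀ φ₁, ∀ l ∈ Ioc (0 : ℝ) 1,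
      (l * (σ * (Real.cos φ * (a ^ 2 / supp a b φ - ρ))),
        l * (σ * (Real.sin φ * (b ^ 2 / supp a b φ - ρ)))) ∈ S)
    (hS2 : ∀ p ∈ S, 0 < p.1 → 0 < p.2 → ∀ φ ∈ Ioo φ₀ φ₁,
      p.1 * Real.cos φ + p.2 * Real.sin φ ≤ σ * (supp a b φ - ρ)) :
    HasCoordArea S (F₁ - F₀) := by
  have A := measurableSet_volume_sector h0 h01 h1 (hasDerivAt_boundary_fst hb hab σ ρ)
    (hasDerivAt_boundary_snd hb hab σ ρ) hw hx0 hy0 hx1 hy1 hS1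
    (by simpa only [boundary_inner hb hab] using hS2)
  simp only [boundary_inner hb hab] at A
  set g : ℝ → ℝ := fun φ => 2 * (supp a b φ - ρ) * (a ^ 2 * b ^ 2 / supp a b φ ^ 3 - ρ) with hg
  have hgc : Continuous g := by
    have c2 := continuous_supp a b
    have c3 : ∀ φ, supp a b φ ^ 3 ≠ 0 := fun φ => (pow_pos (supp_pos hb hab φ) 3).ne'
    fun_prop (disch := assumption)
  have hint : ∫ φ in φ₀..φ₁, g φ = F₁ - F₀ := by
    refine intervalIntegral.integral_eq_sub_of_hasDerivAt_of_tendsto h01 (fun φ hφ => ?_)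
      (hgc.intervalIntegrable _ _) hF0 hF1
    refine hasDerivAt_F hb hab ρ (Real.cos_pos_of_mem_Ioo ⟨?_, ?_⟩).ne'
    · linarith [hφ.1, Real.pi_pos]
    · linarith [hφ.2]
  have hg' : ∀ φ, σ * (supp a b φ - ρ) * (σ * (a ^ 2 * b ^ 2 / supp a b φ ^ 3 - ρ)) / 2
      = g φ / 4 := fun φ => by
    simp only [hg]
    linear_combination (supp a b φ - ρ) * (a ^ 2 * b ^ 2 / supp a b φ ^ 3 - ρ) / 2 * hσ
  have hg0 : ∀ φ ∈ Ioo φ₀ φ₁, 0 ≤ g φ / 4 := fun φ hφ => by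
    rw [← hg']
    exact div_nonneg (mul_nonneg (hk φ hφ) (hw φ hφ).le) zero_le_two
  have hl : ∫⁻ φ in Ioo φ₀ φ₁, ENNReal.ofReal (g φ / 4) = ENNReal.ofReal ((F₁ - F₀) / 4) := by
    rw [← ofReal_integral_eq_lintegral_ofReal, ← integral_Ioc_eq_integral_Ioo,
      ← intervalIntegral.integral_of_le h01.le, intervalIntegral.integral_div, hint]
    · exact ((hgc.div_const 4).integrableOn_Icc).mono_set Ioo_subset_Icc_self
    · exact (ae_restrict_iff' measurableSet_Ioo).2 (Eventually.of_forall hg0)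
  simp only [hg', hl] at A
  obtain ⟨B1, B2⟩ := volume_eq_four_mul_quadrant hsymm1 hsymm2 A.1.nullMeasurableSet
  have hnn : 0 ≤ F₁ - F₀ := by
    rw [← hint, intervalIntegral.integral_of_le h01.le, integral_Ioc_eq_integral_Ioo]
    refine setIntegral_nonneg measurableSet_Ioo fun φ hφ => ?_
    linarith [hg0 φ hφ]
  have B3 : volume S = ENNReal.ofReal (F₁ - F₀) := by
    rw [B2, A.2, show (4 : ENNReal) = ENNReal.ofReal 4 by simp, ← ENNReal.ofReal_mul (by norm_num)]
    congr 1
    ring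
  exact ⟨B1, by rw [B3]; exact ENNReal.ofReal_ne_top, by rw [B3, ENNReal.toReal_ofReal hnn]⟩

/-! ### Inclusion and intersection of disk and ellipse in coordinates -/

theorem exists_polar (x y : ℝ) : ∃ R θ : ℝ, 0 ≤ R ∧ x = R * Real.cos θ ∧ y = R * Real.sin θ :=
  ⟨‖(⟨x, y⟩ : ℂ)‖, Complex.arg ⟨x, y⟩, norm_nonneg _, (Complex.norm_mul_cos_arg ⟨x, y⟩).symm,
    (Complex.norm_mul_sin_arg ⟨x, y⟩).symm⟩

theorem exists_cos_sin {x y : ℝ} (h : x ^ 2 + y ^ 2 = 1) :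
    ∃ θ : ℝ, x = Real.cos θ ∧ y = Real.sin θ := by
  obtain ⟨R, θ, hR, rfl, rfl⟩ := exists_polar x y
  have : R = 1 := by
    have : R ^ 2 = 1 := by linear_combination h - R ^ 2 * Real.sin_sq_add_cos_sq θ
    nlinarith
  exact ⟨θ, by rw [this, one_mul], by rw [this, one_mul]⟩

/-- Positions of the centre of a disk of radius `r` relative to the ellipse for which its bounding
circle lies in the region bounded by the ellipse. -/
def circleIn (a b r : ℝ) : Set (ℝ × ℝ) :=
  {p | ∀ s, ((p.1 + r * Real.cos s) / a) ^ 2 + ((p.2 + r * Real.sin s) / b) ^ 2 ≤ 1}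

/-- Positions of the centre of a disk of radius `r` relative to the ellipse for which the disk
contains the ellipse. -/
def ellipseIn (a b r : ℝ) : Set (ℝ × ℝ) :=
  {p | ∀ t, (a * Real.cos t - p.1) ^ 2 + (b * Real.sin t - p.2) ^ 2 ≤ r ^ 2}

/-- Positions of the centre of a disk of radius `r` relative to the ellipse for which the disk meets
the region bounded by the ellipse. -/
def regionsMeet (a b r : ℝ) : Set (ℝ × ℝ) :=
  {p | ∃ q : ℝ × ℝ, (q.1 / a) ^ 2 + (q.2 / b) ^ 2 ≤ 1 ∧ (q.1 - p.1) ^ 2 + (q.2 - p.2) ^ 2 ≤ r ^ 2}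

section Regions

variable {a b r : ℝ}

/-- Cauchy–Schwarz for (x/a, y/b) and (a cos θ, b sin θ); the defect is an explicit square. -/
theorem le_supp_of_mem (ha : 0 < a) (hb : 0 < b) {x y : ℝ} (h : (x / a) ^ 2 + (y / b) ^ 2 ≤ 1)
    (θ : ℝ) : x * Real.cos θ + y * Real.sin θ ≤ supp a b θ := by
  refine abs_le_of_sq_le_sq' ?_ (supp_nonneg a b θ) |>.2
  have e : (x * Real.cos θ + y * Real.sin θ) ^ 2 ≤
      ((x / a) ^ 2 + (y / b) ^ 2) * supp a b θ ^ 2 := by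
    rw [supp_sq, ← sub_nonneg]
    have : ((x / a) ^ 2 + (y / b) ^ 2) * (a ^ 2 * Real.cos θ ^ 2 + b ^ 2 * Real.sin θ ^ 2) -
        (x * Real.cos θ + y * Real.sin θ) ^ 2 =
        (x / a * (b * Real.sin θ) - y / b * (a * Real.cos θ)) ^ 2 := by
      field_simp
      ring
    rw [this]
    positivity
  nlinarith [sq_nonneg (supp a b θ)]

theorem mem_of_le_supp (hb : 0 < b) (hab : b ≤ a) {x y : ℝ}
    (h : ∀ θ, x * Real.cos θ + y * Real.sin θ ≤ supp a b θ) : (x / a) ^ 2 + (y / b) ^ 2 ≤ 1 := by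
  have ha : 0 < a := hb.trans_le hab
  -- Up to a factor this is the gradient of the quadratic form at (x, y). Its angle θ is therefore
  -- the normal direction in which the support inequality is decisive.
  obtain ⟨R, θ, hR, h1, h2⟩ := exists_polar (x / a ^ 2) (y / b ^ 2)
  have hpos := supp_pos hb hab θ
  have hx : x = a ^ 2 * (R * Real.cos θ) := by rw [← h1]; field_simp
  have hy : y = b ^ 2 * (R * Real.sin θ) := by rw [← h2]; field_simp
  have h3 := h θ
  have h4 : x * Real.cos θ + y * Real.sin θ = R * supp a b θ ^ 2 := by
    rw [supp_sq, hx, hy]; ring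
  have h5 : (x / a) ^ 2 + (y / b) ^ 2 = (R * supp a b θ) ^ 2 := by
    rw [mul_pow, supp_sq, hx, hy]
    field_simp
  rw [h4] at h3
  have h6 : R * supp a b θ ≤ 1 := by
    by_contra! hh
    nlinarith
  rw [h5]
  have := mul_nonneg hR hpos.le
  nlinarith

/-- Inclusion of convex sets is comparison of support functions. It suffices to test, in direction
θ, the point of the circle in that same direction. -/
theorem mem_circleIn_iff (hb : 0 < b) (hab : b ≤ a) (hr : 0 < r) {p : ℝ × ℝ} :
    p ∈ circleIn a b r ↔
      ∀ θ, p.1 * Real.cos θ + p.2 * Real.sin θ + r ≤ supp a b θ := by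
  have ha : 0 < a := hb.trans_le hab
  constructor
  · intro h θ
    have := le_supp_of_mem ha hb (h θ) θ
    linear_combination this - r * Real.sin_sq_add_cos_sq θ
  · intro h s
    refine mem_of_le_supp hb hab fun θ => ?_
    have h1 := h θ
    have h2 : Real.cos s * Real.cos θ + Real.sin s * Real.sin θ ≤ 1 := by
      rw [← Real.cos_sub]
      exact Real.cos_le_one _
    nlinarith

theorem mem_ellipseIn_iff (hb : 0 < b) (hab : b ≤ a) (hr : 0 < r) {p : ℝ × ℝ} :
    p ∈ ellipseIn a b r ↔
      ∀ θ, supp a b θ ≤ r + (p.1 * Real.cos θ + p.2 * Real.sin θ) := by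
  have ha : 0 < a := hb.trans_le hab
  constructor
  · intro h θ
    have hpos := supp_pos hb hab θ
    have hs := supp_sq a b θ
    -- The parameter of the ellipse point with outer normal θ, where the support function is
    -- attained.
    obtain ⟨t, h1, h2⟩ := exists_cos_sin (x := a * Real.cos θ / supp a b θ)
      (y := b * Real.sin θ / supp a b θ) (by
        field_simp
        linear_combination -hs)
    have h3 := h t
    rw [← h1, ← h2] at h3
    set x := a * (a * Real.cos θ / supp a b θ) - p.1 with hx
    set y := b * (b * Real.sin θ / supp a b θ) - p.2 with hy
    have h4 : x * Real.cos θ + y * Real.sin θ ≤ r := by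
      refine abs_le_of_sq_le_sq' ?_ hr.le |>.2
      nlinarith [sq_nonneg (x * Real.sin θ - y * Real.cos θ), Real.sin_sq_add_cos_sq θ]
    have h5 : x * Real.cos θ + y * Real.sin θ + (p.1 * Real.cos θ + p.2 * Real.sin θ)
        = supp a b θ := by
      rw [hx, hy]
      field_simp
      linear_combination -hs
    linarith
  · intro h t
    obtain ⟨R, θ, hR, h1, h2⟩ := exists_polar (a * Real.cos t - p.1) (b * Real.sin t - p.2)
    have h3 := le_supp_of_mem ha hb (x := a * Real.cos t) (y := b * Real.sin t) (by
      rw [mul_div_cancel_left₀ _ ha.ne', mul_div_cancel_left₀ _ hb.ne', Real.cos_sq_add_sin_sq]) θ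
    have h4 := h θ
    have h5 : R ≤ r := by
      have : R = (a * Real.cos t - p.1) * Real.cos θ + (b * Real.sin t - p.2) * Real.sin θ := by
        rw [h1, h2]
        linear_combination (-R) * Real.sin_sq_add_cos_sq θ
      linarith
    calc (a * Real.cos t - p.1) ^ 2 + (b * Real.sin t - p.2) ^ 2 = R ^ 2 := by
          rw [h1, h2]
          linear_combination R ^ 2 * Real.sin_sq_add_cos_sq θ
      _ ≤ r ^ 2 := pow_le_pow_left₀ hR h5 2

theorem inner_le_of_mem_regionsMeet (hb : 0 < b) (hab : b ≤ a) (hr : 0 < r) {p : ℝ × ℝ}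
    (hp : p ∈ regionsMeet a b r) (θ : ℝ) :
    p.1 * Real.cos θ + p.2 * Real.sin θ ≤ supp a b θ + r := by
  obtain ⟨q, h1, h2⟩ := hp
  have h3 := le_supp_of_mem (hb.trans_le hab) hb h1 θ
  have h4 : -r ≤ (q.1 - p.1) * Real.cos θ + (q.2 - p.2) * Real.sin θ := by
    refine abs_le_of_sq_le_sq' ?_ hr.le |>.1
    nlinarith [sq_nonneg ((q.1 - p.1) * Real.sin θ - (q.2 - p.2) * Real.cos θ),
      Real.sin_sq_add_cos_sq θ]
  linarith

/-! ### Symmetries and monotonicity of the support function -/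

theorem supp_add_pi (a b θ : ℝ) : supp a b (θ + Real.pi) = supp a b θ := by
  simp [supp, Real.cos_add_pi, Real.sin_add_pi]

theorem supp_neg (a b θ : ℝ) : supp a b (-θ) = supp a b θ := by
  simp [supp]

theorem supp_pi_sub (a b θ : ℝ) : supp a b (Real.pi - θ) = supp a b θ := by
  simp [supp, Real.cos_pi_sub, Real.sin_pi_sub]

theorem supp_zero (ha : 0 ≤ a) : supp a b 0 = a := by
  simp [supp, Real.sqrt_sq ha]

theorem supp_pi_div_two (hb : 0 ≤ b) : supp a b (Real.pi / 2) = b := by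
  simp [supp, Real.sqrt_sq hb]

theorem supp_lt_supp (hb : 0 < b) (hab : b < a) {φ θ : ℝ} (h0 : 0 ≤ φ) (h : φ < θ)
    (h1 : θ ≤ Real.pi / 2) : supp a b θ < supp a b φ := by
  refine lt_of_pow_lt_pow_left₀ 2 (supp_nonneg a b φ) ?_
  have c1 := Real.cos_lt_cos_of_nonneg_of_le_pi_div_two h0 h1 h
  have c0 : 0 ≤ Real.cos θ := Real.cos_nonneg_of_neg_pi_div_two_le_of_le (by linarith) h1
  have e : Real.cos θ ^ 2 < Real.cos φ ^ 2 := pow_lt_pow_left₀ c1 c0 two_ne_zero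
  have e2 : 0 < a ^ 2 - b ^ 2 := sub_pos.2 (pow_lt_pow_left₀ hab hb.le two_ne_zero)
  rw [supp_sq, supp_sq]
  nlinarith [Real.sin_sq_add_cos_sq φ, Real.sin_sq_add_cos_sq θ, mul_lt_mul_of_pos_left e e2]

/-- For a point of the closed first quadrant the worst direction also lies there, so the support
inequalities need only be checked for nonnegative cosine and sine. -/
theorem abs_inner_le_of_nonneg {c s x y k : ℝ} (hx : 0 ≤ x) (hy : 0 ≤ y)
    (hk : ∀ c' s' : ℝ, 0 ≤ c' → 0 ≤ s' → c' ^ 2 = c ^ 2 → s' ^ 2 = s ^ 2 →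
      x * c' + y * s' ≤ k) : |x * c + y * s| ≤ k := by
  refine le_trans (abs_add_le _ _) ?_
  rw [abs_mul, abs_mul, abs_of_nonneg hx, abs_of_nonneg hy]
  exact hk _ _ (abs_nonneg _) (abs_nonneg _) (sq_abs _) (sq_abs _)

/-- Estimates for the difference between the Cauchy–Schwarz bound and the scalar product of two
unit vectors with respect to the quadratic form of an ellipse. -/
theorem quadratic_gap {C S c s H h : ℝ} (hb : 0 < b) (hab : b ≤ a)
    (hC : 0 ≤ C) (hS : 0 ≤ S) (hc : 0 ≤ c) (hs : 0 ≤ s) (hCS : C ^ 2 + S ^ 2 = 1)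
    (hcs : c ^ 2 + s ^ 2 = 1) (hH : H ^ 2 = a ^ 2 * C ^ 2 + b ^ 2 * S ^ 2)
    (hh : h ^ 2 = a ^ 2 * c ^ 2 + b ^ 2 * s ^ 2)
    (hbH : b ≤ H) (hbh : b ≤ h) (hHa : H ≤ a) (hha : h ≤ a) :
    b ^ 2 * (1 - (C * c + S * s)) ≤ h * H - (a ^ 2 * C * c + b ^ 2 * S * s) ∧
      h * H - (a ^ 2 * C * c + b ^ 2 * S * s) ≤ a ^ 2 * (1 - (C * c + S * s)) := by
  have ha : 0 < a := hb.trans_le hab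
  set q := C * c + S * s with hq
  set m := a ^ 2 * C * c + b ^ 2 * S * s with hm
  have hCc := mul_nonneg hC hc
  have hSs := mul_nonneg hS hs
  have hab2 : b ^ 2 ≤ a ^ 2 := pow_le_pow_left₀ hb.le hab 2
  have hm1 : b ^ 2 * q ≤ m := by rw [hq, hm]; nlinarith
  have hm2 : m ≤ a ^ 2 * q := by rw [hq, hm]; nlinarith
  have hq0 : 0 ≤ q := add_nonneg hCc hSs
  have hq1 : q ≤ 1 := by nlinarith [sq_nonneg (C - c), sq_nonneg (S - s)]
  have hhH1 : b ^ 2 ≤ h * H := by nlinarith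
  have hhH2 : h * H ≤ a ^ 2 := by nlinarith
  -- Both sides are a²b²(Cs - Sc)², by Lagrange's identity for the elliptic and for the Euclidean
  -- scalar product. Division by hH + m, which lies between b²(1 + q) and a²(1 + q), gives the two
  -- estimates.
  have key : (h * H - m) * (h * H + m) = a ^ 2 * b ^ 2 * ((1 - q) * (1 + q)) := by
    have h1 : (h * H - m) * (h * H + m) = h ^ 2 * H ^ 2 - m ^ 2 := by ring
    have h2 : (1 - q) * (1 + q) = (C ^ 2 + S ^ 2) * (c ^ 2 + s ^ 2) - q ^ 2 := by
      rw [hCS, hcs]; ring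
    rw [h1, h2, hH, hh]
    ring
  have hpos : 0 < h * H + m := by nlinarith [sq_pos_of_pos hb]
  have hq1' : 0 ≤ 1 - q := sub_nonneg.2 hq1
  constructor
  · refine le_of_mul_le_mul_right ?_ hpos
    rw [key]
    have : h * H + m ≤ a ^ 2 * (1 + q) := by linarith
    nlinarith [mul_le_mul_of_nonneg_left this (mul_nonneg (sq_nonneg b) hq1')]
  · refine le_of_mul_le_mul_right ?_ hpos
    rw [key]
    have : b ^ 2 * (1 + q) ≤ h * H + m := by linarith
    nlinarith [mul_le_mul_of_nonneg_left this (mul_nonneg (sq_nonneg a) hq1')]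

theorem boundary_quadratic_gap (hb : 0 < b) (hab : b ≤ a) {φ θ c s : ℝ} (hφ0 : 0 ≤ φ)
    (hφ1 : φ ≤ Real.pi / 2) (hc : 0 ≤ c) (hs : 0 ≤ s) (hc2 : c ^ 2 = Real.cos θ ^ 2)
    (hs2 : s ^ 2 = Real.sin θ ^ 2) :
    b ^ 2 * (1 - (Real.cos φ * c + Real.sin φ * s)) ≤ supp a b θ * supp a b φ -
        (a ^ 2 * Real.cos φ * c + b ^ 2 * Real.sin φ * s) ∧
      supp a b θ * supp a b φ - (a ^ 2 * Real.cos φ * c + b ^ 2 * Real.sin φ * s) ≤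
        a ^ 2 * (1 - (Real.cos φ * c + Real.sin φ * s)) := by
  refine quadratic_gap hb hab (Real.cos_nonneg_of_neg_pi_div_two_le_of_le (by linarith) hφ1)
    (Real.sin_nonneg_of_nonneg_of_le_pi hφ0 (by linarith)) hc hs (Real.cos_sq_add_sin_sq φ) ?_
    (supp_sq a b φ) ?_ (le_supp hb hab φ) (le_supp hb hab θ) (supp_le hb hab φ) (supp_le hb hab θ)
  · rw [hc2, hs2, Real.cos_sq_add_sin_sq]
  · rw [hc2, hs2, supp_sq]

theorem inner_le_one_of_sq {φ θ c s : ℝ} (hc2 : c ^ 2 = Real.cos θ ^ 2)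
    (hs2 : s ^ 2 = Real.sin θ ^ 2) : Real.cos φ * c + Real.sin φ * s ≤ 1 := by
  nlinarith [sq_nonneg (Real.cos φ - c), sq_nonneg (Real.sin φ - s), Real.sin_sq_add_cos_sq φ,
    Real.sin_sq_add_cos_sq θ]

/-- These positions form the Minkowski sum of the elliptic region and the disk, bounded by the outer
parallel curve (ρ = -r). A contracted boundary point splits into the contracted ellipse point and a
normal vector of length at most r. -/
theorem hasCoordArea_regionsMeet (hb : 0 < b) (hab : b ≤ a) (hr : 0 < r) :
    HasCoordArea (regionsMeet a b r) (Astar a b (-r)) := by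
  have ha : 0 < a := hb.trans_le hab
  have hpi := Real.pi_pos
  rw [← sub_zero (Astar a b (-r))]
  refine hasCoordArea_of_boundary hb hab (σ := 1) (one_pow 2) le_rfl (by positivity) le_rfl
    (tendsto_F_zero hb hab (-r)) (tendsto_F_pi_div_two hb hab (-r)) (fun φ _ => ?_) (fun φ _ => ?_)
    ?_ (by simp) (by simp) ?_ ?_ ?_ (fun φ _ l hl => ?_) (fun p hp _ _ φ _ => ?_)
  · have := supp_nonneg a b φ
    linarith
  · have := supp_pos hb hab φ
    rw [one_mul, sub_neg_eq_add]
    positivity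
  · have := supp_pos hb hab 0
    rw [one_mul, sub_neg_eq_add, Real.cos_zero]
    positivity
  · have := supp_pos hb hab (Real.pi / 2)
    rw [one_mul, sub_neg_eq_add, Real.sin_pi_div_two]
    positivity
  · rintro p ⟨q, h1, h2⟩
    refine ⟨(-q.1, q.2), ?_, ?_⟩
    · simpa [neg_div] using h1
    · simp only
      linear_combination h2
  · rintro p ⟨q, h1, h2⟩
    refine ⟨(q.1, -q.2), ?_, ?_⟩
    · simpa [neg_div] using h1
    · simp only
      linear_combination h2
  · have hpos := supp_pos hb hab φ
    have hl2 : l ^ 2 ≤ 1 := pow_le_one₀ hl.1.le hl.2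
    refine ⟨(l * (Real.cos φ * (a ^ 2 / supp a b φ)), l * (Real.sin φ * (b ^ 2 / supp a b φ))),
      ?_, ?_⟩
    · have : (l * (Real.cos φ * (a ^ 2 / supp a b φ)) / a) ^ 2 +
          (l * (Real.sin φ * (b ^ 2 / supp a b φ)) / b) ^ 2 = l ^ 2 := by
        have hs := supp_sq a b φ
        field_simp
        linear_combination (-l ^ 2) * hs
      simpa only [this] using hl2
    · have : (l * (Real.cos φ * (a ^ 2 / supp a b φ)) -
          l * (1 * (Real.cos φ * (a ^ 2 / supp a b φ - -r)))) ^ 2 +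
          (l * (Real.sin φ * (b ^ 2 / supp a b φ)) -
          l * (1 * (Real.sin φ * (b ^ 2 / supp a b φ - -r)))) ^ 2 = l ^ 2 * r ^ 2 := by
        linear_combination l ^ 2 * r ^ 2 * Real.sin_sq_add_cos_sq φ
      simp only [this]
      nlinarith [sq_nonneg r]
  · have := inner_le_of_mem_regionsMeet hb hab hr hp φ
    linarith

theorem circleIn_symm (hb : 0 < b) (hab : b ≤ a) (hr : 0 < r) :
    (∀ p ∈ circleIn a b r, (-p.1, p.2) ∈ circleIn a b r) ∧
      ∀ p ∈ circleIn a b r, (p.1, -p.2) ∈ circleIn a b r := by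
  simp only [mem_circleIn_iff hb hab hr]
  refine ⟨fun p h θ => ?_, fun p h θ => ?_⟩
  · have := h (Real.pi - θ)
    rw [supp_pi_sub, Real.cos_pi_sub, Real.sin_pi_sub] at this
    linarith
  · have := h (-θ)
    rw [supp_neg, Real.cos_neg, Real.sin_neg] at this
    linarith

theorem ellipseIn_symm (hb : 0 < b) (hab : b ≤ a) (hr : 0 < r) :
    (∀ p ∈ ellipseIn a b r, (-p.1, p.2) ∈ ellipseIn a b r) ∧
      ∀ p ∈ ellipseIn a b r, (p.1, -p.2) ∈ ellipseIn a b r := by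
  simp only [mem_ellipseIn_iff hb hab hr]
  refine ⟨fun p h θ => ?_, fun p h θ => ?_⟩
  · have := h (Real.pi - θ)
    rw [supp_pi_sub, Real.cos_pi_sub, Real.sin_pi_sub] at this
    linarith
  · have := h (-θ)
    rw [supp_neg, Real.cos_neg, Real.sin_neg] at this
    linarith

/-- The arc starts either on the major axis at φ₀ = 0 or where the inner parallel curve crosses that
axis, namely where rh = b². Beyond this angle rh < b², which keeps the second coordinate positive
and makes the arc satisfy all the support inequalities. -/
theorem hasCoordArea_circleIn (hb : 0 < b) (hab : b ≤ a) (hr : 0 < r) (hrb : r < b) {φ₀ F₀ : ℝ}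
    (h0 : 0 ≤ φ₀) (h01 : φ₀ < Real.pi / 2) (hF0 : Tendsto (F a b r) (𝓝[>] φ₀) (𝓝 F₀))
    (hx0 : r * supp a b φ₀ < a ^ 2) (hy0 : Real.sin φ₀ * (b ^ 2 / supp a b φ₀ - r) = 0)
    (hrH : ∀ φ ∈ Ioo φ₀ (Real.pi / 2), r * supp a b φ < b ^ 2) :
    HasCoordArea (circleIn a b r) (Astar a b r - F₀) := by
  have ha : 0 < a := hb.trans_le hab
  have hab2 : b ^ 2 ≤ a ^ 2 := pow_le_pow_left₀ hb.le hab 2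
  refine hasCoordArea_of_boundary hb hab (σ := 1) (one_pow 2) h0 h01 le_rfl
    hF0 (tendsto_F_pi_div_two hb hab r) (fun φ _ => ?_) (fun φ hφ => ?_)
    ?_ (by rw [hy0, mul_zero]) (by simp) ?_ (circleIn_symm hb hab hr).1 (circleIn_symm hb hab hr).2
    (fun φ hφ l hl => ?_) (fun p hp _ _ φ _ => ?_)
  · have := le_supp hb hab φ
    linarith
  · have hpos := supp_pos hb hab φ
    rw [one_mul, sub_pos, lt_div_iff₀ (by positivity)]
    have h1 := hrH φ hφ
    have h2 := pow_le_pow_left₀ hpos.le (supp_le hb hab φ) 2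
    nlinarith [mul_lt_mul_of_pos_right h1 (pow_pos hpos 2),
      mul_le_mul_of_nonneg_left h2 (sq_nonneg b)]
  · have hpos := supp_pos hb hab φ₀
    rw [one_mul]
    refine mul_pos (Real.cos_pos_of_mem_Ioo ⟨by linarith [Real.pi_pos], h01⟩) ?_
    rwa [sub_pos, lt_div_iff₀ hpos]
  · rw [one_mul, Real.sin_pi_div_two, one_mul, supp_pi_div_two hb.le, sq, mul_div_cancel_right₀ _
      hb.ne']
    linarith
  · rw [mem_circleIn_iff hb hab hr]
    intro θ
    have hpos := supp_pos hb hab φ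
    have hC : 0 ≤ Real.cos φ :=
      Real.cos_nonneg_of_neg_pi_div_two_le_of_le (by linarith [hφ.1]) hφ.2.le
    have hS : 0 ≤ Real.sin φ :=
      Real.sin_nonneg_of_nonneg_of_le_pi (by linarith [hφ.1]) (by linarith [hφ.2])
    have h1 := hrH φ hφ
    -- After multiplication by H = h(φ) the claim reads rH(1 - q) ≤ h(θ)H - m, where q and m are the
    -- Euclidean and the elliptic scalar products of the two directions. The right side is at least
    -- b²(1 - q), and rH < b².
    have key : |1 * (Real.cos φ * (a ^ 2 / supp a b φ - r)) * Real.cos θ +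
        1 * (Real.sin φ * (b ^ 2 / supp a b φ - r)) * Real.sin θ| ≤ supp a b θ - r := by
      refine abs_inner_le_of_nonneg ?_ ?_ fun c s hc hs hc2 hs2 => ?_
      · rw [one_mul]
        refine mul_nonneg hC ?_
        rw [sub_nonneg, le_div_iff₀ hpos]
        linarith
      · rw [one_mul]
        refine mul_nonneg hS ?_
        rw [sub_nonneg, le_div_iff₀ hpos]
        linarith
      · have g := (boundary_quadratic_gap hb hab (by linarith [hφ.1]) hφ.2.le hc hs hc2 hs2).1
        have q1 := inner_le_one_of_sq (φ := φ) hc2 hs2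
        refine le_of_mul_le_mul_right ?_ hpos
        have e : (1 * (Real.cos φ * (a ^ 2 / supp a b φ - r)) * c +
          1 * (Real.sin φ * (b ^ 2 / supp a b φ - r)) * s) * supp a b φ =
          a ^ 2 * Real.cos φ * c + b ^ 2 * Real.sin φ * s
            - r * supp a b φ * (Real.cos φ * c + Real.sin φ * s) := by
          field_simp
          ring
        rw [e]
        nlinarith [mul_le_mul_of_nonneg_right h1.le (sub_nonneg.2 q1)]
    -- Nonnegativity of the bound lets the inequality pass to the points l times the boundary point,
    -- l ≤ 1.
    have k0 := (abs_nonneg _).trans key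
    have k1 := (le_abs_self _).trans key
    simp only
    nlinarith [hl.1, hl.2, mul_le_mul_of_nonneg_left k1 hl.1.le,
      mul_nonneg (sub_nonneg.2 hl.2) k0]
  · have := (mem_circleIn_iff hb hab hr).1 hp φ
    linarith

/-- Dual to the preceding case: the arc starts at φ = 0 and ends at π/2 or where the curve crosses
the minor axis, namely where rh = a². Before that angle rh > a², and the upper estimate h(θ)H - m ≤
a²(1 - q) is the one that is needed. -/
theorem hasCoordArea_ellipseIn (hb : 0 < b) (hab : b ≤ a) (hra : a < r) {φ₁ F₁ : ℝ}
    (h0 : 0 < φ₁) (h1 : φ₁ ≤ Real.pi / 2) (hF1 : Tendsto (F a b r) (𝓝[<] φ₁) (𝓝 F₁))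
    (hx1 : Real.cos φ₁ * (a ^ 2 / supp a b φ₁ - r) = 0) (hy1 : b ^ 2 < r * supp a b φ₁)
    (hrH : ∀ φ ∈ Ioo 0 φ₁, a ^ 2 < r * supp a b φ) :
    HasCoordArea (ellipseIn a b r) F₁ := by
  have ha : 0 < a := hb.trans_le hab
  have hr : 0 < r := ha.trans hra
  have hab2 : b ^ 2 ≤ a ^ 2 := pow_le_pow_left₀ hb.le hab 2
  rw [← sub_zero F₁]
  refine hasCoordArea_of_boundary hb hab (σ := -1) (by norm_num) le_rfl h0 h1
    (tendsto_F_zero hb hab r) hF1 (fun φ _ => ?_) (fun φ hφ => ?_)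
    ?_ (by simp) (by rw [hx1, mul_zero]) ?_ (ellipseIn_symm hb hab hr).1
    (ellipseIn_symm hb hab hr).2 (fun φ hφ l hl => ?_) (fun p hp _ _ φ _ => ?_)
  · have := supp_le hb hab φ
    linarith
  · have hpos := supp_pos hb hab φ
    rw [neg_one_mul, neg_sub, sub_pos, div_lt_iff₀ (by positivity)]
    have h1 := hrH φ hφ
    have h2 := pow_le_pow_left₀ hb.le (le_supp hb hab φ) 2
    nlinarith [mul_lt_mul_of_pos_right h1 (pow_pos hpos 2),
      mul_le_mul_of_nonneg_left h2 (sq_nonneg a)]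
  · rw [Real.cos_zero, supp_zero ha.le, sq, mul_div_cancel_right₀ _ ha.ne']
    linarith
  · have hpos := supp_pos hb hab φ₁
    rw [show -1 * (Real.sin φ₁ * (b ^ 2 / supp a b φ₁ - r)) =
      Real.sin φ₁ * (r - b ^ 2 / supp a b φ₁) by ring]
    refine mul_pos (Real.sin_pos_of_pos_of_lt_pi h0 (by linarith [Real.pi_pos])) ?_
    rwa [sub_pos, div_lt_iff₀ hpos]
  · rw [mem_ellipseIn_iff hb hab hr]
    intro θ
    have hpos := supp_pos hb hab φ
    have hC : 0 ≤ Real.cos φ :=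
      Real.cos_nonneg_of_neg_pi_div_two_le_of_le (by linarith [hφ.1]) (by linarith [hφ.2])
    have hS : 0 ≤ Real.sin φ :=
      Real.sin_nonneg_of_nonneg_of_le_pi (by linarith [hφ.1]) (by linarith [hφ.2])
    have h1 := hrH φ hφ
    have key : |-1 * (Real.cos φ * (a ^ 2 / supp a b φ - r)) * Real.cos θ +
        -1 * (Real.sin φ * (b ^ 2 / supp a b φ - r)) * Real.sin θ| ≤ r - supp a b θ := by
      refine abs_inner_le_of_nonneg ?_ ?_ fun c s hc hs hc2 hs2 => ?_
      · rw [show -1 * (Real.cos φ * (a ^ 2 / supp a b φ - r)) =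
          Real.cos φ * (r - a ^ 2 / supp a b φ) by ring]
        refine mul_nonneg hC ?_
        rw [sub_nonneg, div_le_iff₀ hpos]
        linarith
      · rw [show -1 * (Real.sin φ * (b ^ 2 / supp a b φ - r)) =
          Real.sin φ * (r - b ^ 2 / supp a b φ) by ring]
        refine mul_nonneg hS ?_
        rw [sub_nonneg, div_le_iff₀ hpos]
        linarith
      · have g := (boundary_quadratic_gap hb hab hφ.1.le (by linarith [hφ.2]) hc hs hc2 hs2).2
        have q1 := inner_le_one_of_sq (φ := φ) hc2 hs2
        refine le_of_mul_le_mul_right ?_ hpos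
        have e : (-1 * (Real.cos φ * (a ^ 2 / supp a b φ - r)) * c +
          -1 * (Real.sin φ * (b ^ 2 / supp a b φ - r)) * s) * supp a b φ =
          r * supp a b φ * (Real.cos φ * c + Real.sin φ * s)
            - (a ^ 2 * Real.cos φ * c + b ^ 2 * Real.sin φ * s) := by
          field_simp
          ring
        rw [e]
        nlinarith [mul_le_mul_of_nonneg_right h1.le (sub_nonneg.2 q1)]
    have k0 := (abs_nonneg _).trans key
    have k1 := (neg_le_abs _).trans key
    simp only
    nlinarith [hl.1, hl.2, mul_le_mul_of_nonneg_left k1 hl.1.le,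
      mul_nonneg (sub_nonneg.2 hl.2) k0]
  -- With σ = -1 the bound in direction φ comes from the support inequality in the opposite
  -- direction.
  · have := (mem_ellipseIn_iff hb hab hr).1 hp (φ + Real.pi)
    rw [supp_add_pi, Real.cos_add_pi, Real.sin_add_pi] at this
    linarith

/-! ### The inclusion areas in the different ranges of the radius -/

theorem hasCoordArea_circleIn_of_le (hb : 0 < b) (hab : b ≤ a) (hr : 0 < r) (hbr : b ≤ r) :
    HasCoordArea (circleIn a b r) 0 := by
  refine hasCoordArea_of_null (measure_mono_null (fun p hp => ?_) ae_snd_ne_zero)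
  have h := (mem_circleIn_iff hb hab hr).1 hp
  -- The two opposite inequalities ±y + r ≤ b, together with b ≤ r, leave only the line y = 0.
  have h1 := h (Real.pi / 2)
  have h2 := h (-(Real.pi / 2))
  rw [supp_neg] at h2
  simp only [Real.cos_neg, Real.sin_neg, Real.cos_pi_div_two, Real.sin_pi_div_two,
    supp_pi_div_two hb.le] at h1 h2
  simp only [mem_compl_iff, mem_ofPred_eq, not_not]
  linarith

theorem hasCoordArea_ellipseIn_of_le (hb : 0 < b) (hab : b ≤ a) (hr : 0 < r) (hra : r ≤ a) :
    HasCoordArea (ellipseIn a b r) 0 := by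
  have ha : 0 < a := hb.trans_le hab
  refine hasCoordArea_of_null (measure_mono_null (fun p hp => ?_) ae_fst_ne_zero)
  have h := (mem_ellipseIn_iff hb hab hr).1 hp
  have h1 := h 0
  have h2 := h (0 + Real.pi)
  rw [supp_add_pi, Real.cos_add_pi, Real.sin_add_pi] at h2
  simp only [Real.cos_zero, Real.sin_zero, supp_zero ha.le] at h1 h2
  simp only [mem_compl_iff, mem_ofPred_eq, not_not]
  linarith

theorem Astar_self (ha : 0 < a) : Astar a a a = 0 := by
  have : ∀ θ, supp a a θ = a := fun θ =>
    le_antisymm (supp_le ha le_rfl θ) (le_supp ha le_rfl θ)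
  rw [Astar_eq ha le_rfl]
  simp only [this, intervalIntegral.integral_const, smul_eq_mul]
  ring

theorem hasCoordArea_circleIn_of_le_div (hb : 0 < b) (hab : b ≤ a) (hr : 0 < r)
    (h : r ≤ b ^ 2 / a) : HasCoordArea (circleIn a b r) (Astar a b r) := by
  have ha : 0 < a := hb.trans_le hab
  rw [le_div_iff₀ ha] at h
  -- For a = b the support function is constant and not strictly decreasing, so circles are treated
  -- separately. If moreover r = b, the region is a null set and A* vanishes.
  rcases hab.eq_or_lt with rfl | hlt
  · rcases (show r ≤ b by nlinarith).eq_or_lt with rfl | hrb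
    · rw [Astar_self hb]
      exact hasCoordArea_circleIn_of_le hb le_rfl hb le_rfl
    · rw [← sub_zero (Astar b b r)]
      have e : ∀ φ, supp b b φ = b := fun φ =>
        le_antisymm (supp_le hb le_rfl φ) (le_supp hb le_rfl φ)
      refine hasCoordArea_circleIn hb le_rfl hr hrb le_rfl (by positivity)
        (tendsto_F_zero hb le_rfl r) ?_ (by simp) fun φ _ => ?_
      · rw [e]; nlinarith
      · rw [e]; nlinarith
  · rw [← sub_zero (Astar a b r)]
    refine hasCoordArea_circleIn hb hab hr (by nlinarith) le_rfl (by positivity)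
      (tendsto_F_zero hb hab r) ?_ (by simp) fun φ hφ => ?_
    · rw [supp_zero ha.le]; nlinarith
    · have := supp_lt_supp hb hlt le_rfl hφ.1 hφ.2.le
      rw [supp_zero ha.le] at this
      nlinarith

theorem hasCoordArea_ellipseIn_of_div_le (hb : 0 < b) (hab : b ≤ a)
    (h : a ^ 2 / b ≤ r) : HasCoordArea (ellipseIn a b r) (Astar a b r) := by
  have ha : 0 < a := hb.trans_le hab
  rw [div_le_iff₀ hb] at h
  have hr : 0 < r := by
    by_contra! hh
    nlinarith [sq_pos_of_pos ha]
  have hpi := Real.pi_pos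
  rcases hab.eq_or_lt with rfl | hlt
  · rcases (show b ≤ r by nlinarith).eq_or_lt with rfl | hrb
    · rw [Astar_self hb]
      exact hasCoordArea_ellipseIn_of_le hb le_rfl hb le_rfl
    · have e : ∀ φ, supp b b φ = b := fun φ =>
        le_antisymm (supp_le hb le_rfl φ) (le_supp hb le_rfl φ)
      refine hasCoordArea_ellipseIn hb le_rfl hrb (by positivity) le_rfl
        (tendsto_F_pi_div_two hb le_rfl r) (by simp) ?_ fun φ _ => ?_
      · rw [e]; nlinarith
      · rw [e]; nlinarith
  · refine hasCoordArea_ellipseIn hb hab (by nlinarith) (by positivity) le_rfl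
      (tendsto_F_pi_div_two hb hab r) (by simp) ?_ fun φ hφ => ?_
    · rw [supp_pi_div_two hb.le]; nlinarith
    · have := supp_lt_supp hb hlt hφ.1.le hφ.2 le_rfl
      rw [supp_pi_div_two hb.le] at this
      nlinarith

theorem supp_arctan {x H : ℝ} (hH : 0 ≤ H)
    (h : a ^ 2 + b ^ 2 * x ^ 2 = H ^ 2 * (1 + x ^ 2)) : supp a b (Real.arctan x) = H := by
  have e : supp a b (Real.arctan x) ^ 2 = H ^ 2 := by
    rw [supp_sq, Real.sin_sq, Real.cos_sq_arctan]
    field_simp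
    linear_combination h
  exact (sq_eq_sq₀ (supp_nonneg _ _ _) hH).1 e

/-- The angle α is chosen so that h(α) = b²/r, which makes the second coordinate of the inner
parallel curve vanish. Strict decrease of h gives rh < b² beyond α. -/
theorem hasCoordArea_circleIn_of_lt (hb : 0 < b) (hab : b ≤ a) (h : b ^ 2 / a < r)
    (hrb : r < b) : HasCoordArea (circleIn a b r) (Ftilde a b r (alpha a b r)) := by
  have ha : 0 < a := hb.trans_le hab
  have hr : 0 < r := lt_trans (by positivity) h
  rw [div_lt_iff₀ ha] at h
  have hlt : b < a := by
    refine hab.lt_of_ne ?_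
    rintro rfl
    nlinarith
  have h1 : 0 < r ^ 2 * a ^ 2 - b ^ 4 := by nlinarith [sq_nonneg b]
  have h2 : 0 < b ^ 2 - r ^ 2 := by nlinarith
  have hα0 : 0 < alpha a b r := by
    rw [alpha, Real.arctan_pos]
    have := Real.sqrt_pos.2 h1
    have := Real.sqrt_pos.2 h2
    positivity
  have hα1 : alpha a b r < Real.pi / 2 := Real.arctan_lt_pi_div_two _
  have hs : supp a b (alpha a b r) = b ^ 2 / r := by
    refine supp_arctan (by positivity) ?_
    rw [div_pow, mul_pow, Real.sq_sqrt h1.le, Real.sq_sqrt h2.le]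
    field_simp
    ring
  refine hasCoordArea_circleIn hb hab hr hrb hα0.le hα1
    ((hasDerivAt_F hb hab r (Real.cos_arctan_pos _).ne').continuousAt.tendsto.mono_left
      nhdsWithin_le_nhds) ?_ ?_ fun φ hφ => ?_
  · rw [hs, mul_div_cancel₀ _ hr.ne']
    nlinarith
  · rw [hs]
    field_simp
    simp
  · have := supp_lt_supp hb hlt hα0.le hφ.1 hφ.2.le
    rw [hs, lt_div_iff₀ hr] at this
    linarith

/-- The angle β is chosen so that h(β) = a²/r, which makes the first coordinate of the boundary
curve vanish. Strict decrease of h gives rh > a² before β. -/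
theorem hasCoordArea_ellipseIn_of_lt (hb : 0 < b) (hab : b ≤ a) (har : a < r)
    (h : r < a ^ 2 / b) : HasCoordArea (ellipseIn a b r) (F a b r (beta a b r)) := by
  have ha : 0 < a := hb.trans_le hab
  have hr : 0 < r := ha.trans har
  rw [lt_div_iff₀ hb] at h
  have hlt : b < a := by
    refine hab.lt_of_ne ?_
    rintro rfl
    nlinarith
  have h1 : 0 < r ^ 2 - a ^ 2 := by nlinarith
  have h2 : 0 < a ^ 4 - r ^ 2 * b ^ 2 := by nlinarith [sq_nonneg a, mul_pos hr hb]
  have hβ0 : 0 < beta a b r := by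
    rw [beta, Real.arctan_pos]
    have := Real.sqrt_pos.2 h1
    have := Real.sqrt_pos.2 h2
    positivity
  have hβ1 : beta a b r < Real.pi / 2 := Real.arctan_lt_pi_div_two _
  have hs : supp a b (beta a b r) = a ^ 2 / r := by
    refine supp_arctan (by positivity) ?_
    rw [div_pow, mul_pow, Real.sq_sqrt h1.le, Real.sq_sqrt h2.le]
    obtain ⟨d, hd⟩ : ∃ d, d = a ^ 4 - r ^ 2 * b ^ 2 := ⟨_, rfl⟩
    rw [← hd] at h2 ⊢
    field_simp
    rw [hd]
    ring
  refine hasCoordArea_ellipseIn hb hab har hβ0 hβ1.le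
    ((hasDerivAt_F hb hab r (Real.cos_arctan_pos _).ne').continuousAt.tendsto.mono_left
      nhdsWithin_le_nhds) ?_ ?_ fun φ hφ => ?_
  · rw [hs]
    field_simp
    simp
  · rw [hs, mul_div_cancel₀ _ hr.ne']
    nlinarith
  · have := supp_lt_supp hb hlt hφ.1.le hφ.2 hβ1.le
    rw [hs, div_lt_iff₀ hr] at this
    linarith

end Regions

/-! ### Zeros of trigonometric polynomials of degree two -/

open Polynomial in
theorem exists_root_of_odd_natDegree {q : ℝ[X]} (hq : Odd q.natDegree) : ∃ x, q.IsRoot x := by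
  have hdeg : 0 < q.degree := natDegree_pos_iff_degree_pos.1 hq.pos
  have hq0 : q ≠ 0 := ne_zero_of_degree_gt hdeg
  have pos : ∀ p : ℝ[X], 0 < p.degree → 0 ≤ p.leadingCoeff → ∃ x, 0 ≤ p.eval x := fun p h1 h2 =>
    ((p.tendsto_atTop_of_leadingCoeff_nonneg h1 h2).eventually_ge_atTop 0).exists
  have neg : ∀ p : ℝ[X], 0 < p.degree → p.leadingCoeff ≤ 0 → ∃ x, p.eval x ≤ 0 := fun p h1 h2 =>
    ((p.tendsto_atBot_of_leadingCoeff_nonpos h1 h2).eventually_le_atBot 0).exists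
  have hn : (q.comp (-X)).natDegree = q.natDegree := by
    rw [natDegree_comp, natDegree_neg, natDegree_X, mul_one]
  have hdeg' : 0 < (q.comp (-X)).degree := by
    rw [← natDegree_pos_iff_degree_pos, hn]
    exact hq.pos
  have hl : (q.comp (-X)).leadingCoeff = -q.leadingCoeff := by
    rw [leadingCoeff_comp (by rw [natDegree_neg, natDegree_X]; exact one_ne_zero),
      leadingCoeff_neg, leadingCoeff_X, hq.neg_one_pow, mul_neg_one]
  have he : ∀ x, (q.comp (-X)).eval x = q.eval (-x) := fun x => by simp
  obtain ⟨x, hx⟩ : (0 : ℝ) ∈ range fun x => q.eval x := by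
    refine mem_range_of_exists_le_of_exists_ge q.continuous ?_ ?_
    · rcases le_total q.leadingCoeff 0 with h | h
      · exact neg q hdeg h
      · obtain ⟨x, hx⟩ := neg _ hdeg' (by rw [hl]; linarith)
        exact ⟨-x, by rwa [← he]⟩
    · rcases le_total q.leadingCoeff 0 with h | h
      · obtain ⟨x, hx⟩ := pos _ hdeg' (by rw [hl]; linarith)
        exact ⟨-x, by rwa [← he]⟩
      · exact pos q hdeg h
  exact ⟨x, hx⟩

-- After all real linear factors are split off, the cofactor has no real root and hence even degree,
-- so the number of real roots has the parity of 4.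
open Polynomial in
theorem card_roots_of_natDegree_eq_four {Q : ℝ[X]} (hQ : Q.natDegree = 4) :
    Multiset.card Q.roots = 0 ∨ Multiset.card Q.roots = 2 ∨ Multiset.card Q.roots = 4 := by
  obtain ⟨q, h1, h2, h3⟩ := Q.exists_prod_multiset_X_sub_C_mul
  have heven : ¬ Odd q.natDegree := by
    intro hodd
    obtain ⟨x, hx⟩ := exists_root_of_odd_natDegree hodd
    have hq0 : q ≠ 0 := by
      rintro rfl
      simp at hodd
    have := (mem_roots hq0).2 hx
    simp [h3] at this
  rw [Nat.not_odd_iff_even] at heven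
  obtain ⟨k, hk⟩ := heven
  omega

/-- The equation of the circle with centre `p` and radius `r`, pulled back to the ellipse
in normal position. -/
def circleEq (a b r : ℝ) (p : ℝ × ℝ) (t : ℝ) : ℝ :=
  (a * Real.cos t - p.1) ^ 2 + (b * Real.sin t - p.2) ^ 2 - r ^ 2

/-- The derivative of `circleEq`. -/
def circleEqDeriv (a b : ℝ) (p : ℝ × ℝ) (t : ℝ) : ℝ :=
  2 * ((b * Real.sin t - p.2) * (b * Real.cos t) - (a * Real.cos t - p.1) * (a * Real.sin t))

theorem hasDerivAt_circleEq (a b r : ℝ) (p : ℝ × ℝ) (t : ℝ) :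
    HasDerivAt (circleEq a b r p) (circleEqDeriv a b p t) t := by
  refine ((((((Real.hasDerivAt_cos t).const_mul a).sub_const p.1).pow 2).add
    ((((Real.hasDerivAt_sin t).const_mul b).sub_const p.2).pow 2)).sub_const (r ^ 2)).congr_deriv ?_
  simp [circleEqDeriv]
  ring

theorem continuous_circleEq (a b r : ℝ) (p : ℝ × ℝ) : Continuous (circleEq a b r p) := by
  unfold circleEq
  fun_prop

theorem cos_pi_add_two_arctan (w : ℝ) :
    Real.cos (Real.pi + 2 * Real.arctan w) = -(1 - w ^ 2) / (1 + w ^ 2) := by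
  rw [add_comm, Real.cos_add_pi, Real.cos_two_mul, Real.cos_sq_arctan]
  have : 1 + w ^ 2 ≠ 0 := by positivity
  field_simp
  ring

theorem sin_pi_add_two_arctan (w : ℝ) :
    Real.sin (Real.pi + 2 * Real.arctan w) = -(2 * w) / (1 + w ^ 2) := by
  rw [add_comm, Real.sin_add_pi, Real.sin_two_mul, Real.sin_arctan, Real.cos_arctan]
  have h : 0 < 1 + w ^ 2 := by positivity
  have h1 := Real.sqrt_pos.2 h
  have h2 := Real.sq_sqrt h.le
  rw [neg_div, neg_inj]
  field_simp
  rw [h2]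

open Polynomial in
/-- The quartic polynomial obtained from `circleEq` by the half-angle substitution. -/
def halfAngleQuartic (a b r : ℝ) (p : ℝ × ℝ) : ℝ[X] :=
  C ((a - p.1) ^ 2 + p.2 ^ 2 - r ^ 2) * X ^ 4 + C (4 * b * p.2) * X ^ 3 +
    C (2 * (a + p.1) * (p.1 - a) + 4 * b ^ 2 + 2 * p.2 ^ 2 - 2 * r ^ 2) * X ^ 2 +
    C (4 * b * p.2) * X + C ((a + p.1) ^ 2 + p.2 ^ 2 - r ^ 2)

theorem eval_halfAngleQuartic (a b r : ℝ) (p : ℝ × ℝ) (w : ℝ) :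
    (halfAngleQuartic a b r p).eval w =
      circleEq a b r p (Real.pi + 2 * Real.arctan w) * (1 + w ^ 2) ^ 2 := by
  rw [circleEq, cos_pi_add_two_arctan, sin_pi_add_two_arctan]
  have : 1 + w ^ 2 ≠ 0 := by positivity
  simp only [halfAngleQuartic, Polynomial.eval_add, Polynomial.eval_mul, Polynomial.eval_C,
    Polynomial.eval_pow, Polynomial.eval_X]
  field_simp
  ring

/-- The parameters in a period of the intersection points of ellipse and circle. -/
def zeroParams (a b r : ℝ) (p : ℝ × ℝ) : Set ℝ :=
  {t | t ∈ Ico 0 (2 * Real.pi) ∧ circleEq a b r p t = 0}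

/-- The substitution t = π + 2 arctan w maps the line bijectively onto (0, 2π). The missing
parameter t = 0 is not a zero by assumption, and its value is the leading coefficient, so the
polynomial really has degree 4. -/
theorem encard_zeroParams {a b r : ℝ} {p : ℝ × ℝ} (h0 : circleEq a b r p 0 ≠ 0)
    (hsimple : ∀ t, circleEq a b r p t = 0 → circleEqDeriv a b p t ≠ 0) :
    (zeroParams a b r p).encard = 0 ∨ (zeroParams a b r p).encard = 2 ∨
      (zeroParams a b r p).encard = 4 := by
  classical
  set Q := halfAngleQuartic a b r p with hQ
  have hlead : (a - p.1) ^ 2 + p.2 ^ 2 - r ^ 2 ≠ 0 := by simpa [circleEq] using h0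
  have hdeg : Q.natDegree = 4 := by
    rw [hQ, halfAngleQuartic]
    compute_degree!
  have hQ0 : Q ≠ 0 := by
    intro h
    simp [h] at hdeg
  have heval : ∀ w, Q.eval w =
      circleEq a b r p (Real.pi + 2 * Real.arctan w) * (1 + w ^ 2) ^ 2 :=
    eval_halfAngleQuartic a b r p
  have hroot : ∀ w, Q.IsRoot w ↔ circleEq a b r p (Real.pi + 2 * Real.arctan w) = 0 := by
    intro w
    have : (1 + w ^ 2) ^ 2 ≠ 0 := by positivity
    rw [Polynomial.IsRoot.def, heval, mul_eq_zero, or_iff_left this]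
  have hnodup : Q.roots.Nodup := by
    rw [Multiset.nodup_iff_count_le_one]
    intro w
    rw [Polynomial.count_roots]
    -- At a zero, the derivative of the quartic is the derivative of the circle equation times a
    -- nonzero factor; a multiple root would thus be a contact.
    by_contra! hlt
    obtain ⟨hr1, hr2⟩ := (Polynomial.one_lt_rootMultiplicity_iff_isRoot hQ0).1 hlt
    rw [hroot] at hr1
    have hw : 1 + w ^ 2 ≠ 0 := by positivity
    have d1 : HasDerivAt (fun w => circleEq a b r p (Real.pi + 2 * Real.arctan w))
        (circleEqDeriv a b p (Real.pi + 2 * Real.arctan w) * (2 * (1 / (1 + w ^ 2)))) w :=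
      (hasDerivAt_circleEq a b r p _).comp w
        (((Real.hasDerivAt_arctan w).const_mul 2).const_add Real.pi)
    have d2 : HasDerivAt (fun w : ℝ => (1 + w ^ 2) ^ 2) (4 * w * (1 + w ^ 2)) w := by
      refine ((((hasDerivAt_id w).pow 2).const_add 1).pow 2).congr_deriv ?_
      simp
      ring
    have d3 := (d1.mul d2).congr_of_eventuallyEq (f₁ := fun w => Q.eval w)
      (Eventually.of_forall heval)
    have e := d3.unique (Q.hasDerivAt w)
    rw [hr2, hr1, zero_mul, add_zero] at e
    refine hsimple _ hr1 ?_
    have hne : 2 * (1 / (1 + w ^ 2)) * (1 + w ^ 2) ^ 2 ≠ 0 := by positivity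
    rw [mul_assoc] at e
    exact (mul_eq_zero.1 e).resolve_right hne
  have himage : zeroParams a b r p =
      (fun w => Real.pi + 2 * Real.arctan w) '' (Q.roots.toFinset : Set ℝ) := by
    ext t
    simp only [mem_image, Finset.mem_coe, Multiset.mem_toFinset, Polynomial.mem_roots hQ0, hroot]
    constructor
    · rintro ⟨⟨ht0, ht1⟩, ht⟩
      have ht0' : 0 < t := ht0.lt_of_ne (by rintro rfl; exact h0 ht)
      have e : Real.pi + 2 * Real.arctan (Real.tan ((t - Real.pi) / 2)) = t := by
        rw [Real.arctan_tan (by linarith) (by linarith)]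
        ring
      exact ⟨_, by rwa [e], e⟩
    · rintro ⟨w, hw, rfl⟩
      have h1 := Real.neg_pi_div_two_lt_arctan w
      have h2 := Real.arctan_lt_pi_div_two w
      exact ⟨⟨by linarith, by linarith⟩, hw⟩
  have hinj : Function.Injective fun w => Real.pi + 2 * Real.arctan w := by
    intro x y hxy
    simp only at hxy
    exact Real.arctan_injective (by linarith)
  have hcard : (zeroParams a b r p).encard = (Multiset.card Q.roots : ℕ) := by
    rw [himage, hinj.encard_image, encard_coe_eq_coe_finsetCard,
      Multiset.toFinset_card_of_nodup hnodup]
  rw [hcard]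
  rcases card_roots_of_natDegree_eq_four hdeg with h | h | h <;> simp [h]

/-! ### The count of intersection points -/

/-- The sum of the orders of vanishing of `g` at the points of `[0, 2π)` with property `P`. -/
def orderSum (P : ℝ → Prop) (g : ℝ → ℝ) : ℕ∞ :=
  ⨆ s : Finset {t : ℝ // t ∈ Ico 0 (2 * Real.pi) ∧ P t}, ∑ t ∈ s, analyticOrderAt g t

/-- The number of zeros of `circleEq` in a period, counted with multiplicities. -/
def zeroCount (a b r : ℝ) (p : ℝ × ℝ) : ℕ∞ :=
  orderSum (fun t => circleEq a b r p t = 0) (circleEq a b r p)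

theorem zeroCount_eq_encard {a b r : ℝ} {p : ℝ × ℝ}
    (hsimple : ∀ t, circleEq a b r p t = 0 → circleEqDeriv a b p t ≠ 0) :
    zeroCount a b r p = (zeroParams a b r p).encard := by
  have hord : ∀ t, circleEq a b r p t = 0 → analyticOrderAt (circleEq a b r p) t = 1 := by
    intro t ht
    refine AnalyticAt.analyticOrderAt_eq_one_of_zero_deriv_ne_zero ?_ ht ?_
    · unfold circleEq
      fun_prop
    · rw [(hasDerivAt_circleEq a b r p t).deriv]
      exact hsimple t ht
  have hsum : ∀ s : Finset {t : ℝ // t ∈ Ico 0 (2 * Real.pi) ∧ circleEq a b r p t = 0},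
      ∑ t ∈ s, analyticOrderAt (circleEq a b r p) t = (s.card : ℕ∞) := by
    intro s
    rw [Finset.sum_congr (g := fun _ => (1 : ℕ∞)) rfl fun t _ => hord t.1 t.2.2]
    simp
  rw [zeroCount, orderSum]
  simp only [hsum]
  refine le_antisymm (iSup_le fun s => ?_) ?_
  · rw [← encard_coe_eq_coe_finsetCard, ← Subtype.val_injective.encard_image]
    refine encard_le_encard ?_
    rintro _ ⟨t, -, rfl⟩
    exact t.2
  · refine ENat.forall_natCast_le_iff_le.1 fun n hn => ?_
    obtain ⟨u, hu, hun⟩ := exists_subset_encard_eq hn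
    have hfin : u.Finite := finite_of_encard_eq_coe hun
    have hfin' : (Subtype.val ⁻¹' u :
        Set {t : ℝ // t ∈ Ico 0 (2 * Real.pi) ∧ circleEq a b r p t = 0}).Finite :=
      hfin.preimage Subtype.val_injective.injOn
    refine le_trans (le_of_eq ?_) (le_iSup _ hfin'.toFinset)
    rw [← hun, ← encard_coe_eq_coe_finsetCard, Finite.coe_toFinset,
      ← Subtype.val_injective.encard_image,
      image_preimage_eq_of_subset fun x hx => ⟨⟨x, hu hx⟩, rfl⟩]

/-! ### The incidence map -/

/-- The centre of the circle of radius `r` whose point in the direction of angle `s + π` is the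
point of the ellipse with parameter `t`. -/
def incidence (a b r : ℝ) (z : ℝ × ℝ) : ℝ × ℝ :=
  (a * Real.cos z.1 + r * Real.cos z.2, b * Real.sin z.1 + r * Real.sin z.2)

/-- The Jacobian determinant of the incidence map. -/
def incidenceDet (a b r : ℝ) (z : ℝ × ℝ) : ℝ :=
  r * (b * Real.cos z.1 * Real.sin z.2 - a * Real.sin z.1 * Real.cos z.2)

/-- The derivative of the incidence map. -/
def incidenceDeriv (a b r : ℝ) (z : ℝ × ℝ) : ℝ × ℝ →L[ℝ] ℝ × ℝ :=
  matrixMap (-(a * Real.sin z.1)) (-(r * Real.sin z.2)) (b * Real.cos z.1) (r * Real.cos z.2)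

theorem det_incidenceDeriv (a b r : ℝ) (z : ℝ × ℝ) :
    (incidenceDeriv a b r z).det = incidenceDet a b r z := by
  rw [incidenceDeriv, det_matrixMap, incidenceDet]
  ring

theorem hasStrictFDerivAt_incidence (a b r : ℝ) (z : ℝ × ℝ) :
    HasStrictFDerivAt (incidence a b r) (incidenceDeriv a b r z) z := by
  rw [incidenceDeriv, matrixMap_eq_prod]
  have c1 := (Real.hasStrictDerivAt_cos z.1).comp_hasStrictFDerivAt z
    (hasStrictFDerivAt_fst (𝕜 := ℝ) (E := ℝ) (F := ℝ) (p := z))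
  have c2 := (Real.hasStrictDerivAt_cos z.2).comp_hasStrictFDerivAt z
    (hasStrictFDerivAt_snd (𝕜 := ℝ) (E := ℝ) (F := ℝ) (p := z))
  have s1 := (Real.hasStrictDerivAt_sin z.1).comp_hasStrictFDerivAt z
    (hasStrictFDerivAt_fst (𝕜 := ℝ) (E := ℝ) (F := ℝ) (p := z))
  have s2 := (Real.hasStrictDerivAt_sin z.2).comp_hasStrictFDerivAt z
    (hasStrictFDerivAt_snd (𝕜 := ℝ) (E := ℝ) (F := ℝ) (p := z))
  refine HasStrictFDerivAt.prodMk ?_ ?_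
  · refine ((c1.const_mul a).add (c2.const_mul r)).congr_fderiv ?_
    ext <;> simp
  · refine ((s1.const_mul b).add (s2.const_mul r)).congr_fderiv ?_
    ext <;> simp

theorem continuous_incidenceDet (a b r : ℝ) : Continuous (incidenceDet a b r) := by
  unfold incidenceDet
  fun_prop

theorem circleEq_incidence (a b r : ℝ) (z : ℝ × ℝ) :
    circleEq a b r (incidence a b r z) z.1 = 0 := by
  simp only [circleEq, incidence]
  linear_combination r ^ 2 * Real.sin_sq_add_cos_sq z.2

/-- Critical points of the incidence map are exactly the contacts of the two curves, so generic
transversality becomes a statement about critical values. -/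
theorem circleEqDeriv_incidence (a b r : ℝ) (z : ℝ × ℝ) :
    circleEqDeriv a b (incidence a b r z) z.1 = -2 * incidenceDet a b r z := by
  simp only [circleEqDeriv, incidence, incidenceDet]
  ring

theorem exists_incidence_eq {a b r : ℝ} (hr : 0 < r) {p : ℝ × ℝ} {t : ℝ}
    (h : circleEq a b r p t = 0) : ∃ s, incidence a b r (t, s) = p := by
  obtain ⟨s, h1, h2⟩ := exists_cos_sin (x := (p.1 - a * Real.cos t) / r)
    (y := (p.2 - b * Real.sin t) / r) (by
      rw [circleEq] at h
      field_simp
      linear_combination h)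
  refine ⟨s, Prod.ext ?_ ?_⟩
  · simp only [incidence, ← h1]
    field_simp
    ring
  · simp only [incidence, ← h2]
    field_simp
    ring

theorem exists_mem_Ico_cos_sin (s : ℝ) : ∃ s' ∈ Ico 0 (2 * Real.pi),
    Real.cos s' = Real.cos s ∧ Real.sin s' = Real.sin s := by
  refine ⟨toIcoMod Real.two_pi_pos 0 s, by simpa using toIcoMod_mem_Ico Real.two_pi_pos 0 s, ?_⟩
  have e : toIcoMod Real.two_pi_pos 0 s =
      s - toIcoDiv Real.two_pi_pos 0 s * (2 * Real.pi) := by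
    rw [toIcoMod, zsmul_eq_mul]
  rw [e, Real.cos_sub_int_mul_two_pi, Real.sin_sub_int_mul_two_pi]
  exact ⟨rfl, rfl⟩

theorem eq_of_cos_eq_of_sin_eq {s s' : ℝ} (hs : s ∈ Ico 0 (2 * Real.pi))
    (hs' : s' ∈ Ico 0 (2 * Real.pi)) (hc : Real.cos s = Real.cos s')
    (h : Real.sin s = Real.sin s') : s = s' := by
  -- The unit circle is the ellipse with both semi-axes 1.
  refine (bijOn_ellipsePoint one_pos one_pos 0 0).injOn hs hs' ?_
  rw [ellipsePoint, ellipsePoint, hc, h]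

/-- The circle with centre `p` and the ellipse are in general position. -/
def IsGeneric (a b r : ℝ) (p : ℝ × ℝ) : Prop :=
  circleEq a b r p 0 ≠ 0 ∧ ∀ z, incidence a b r z = p → incidenceDet a b r z ≠ 0

/-- Critical values form a null set by Sard's theorem, and the positions with an intersection at
parameter 0 form the smooth image of a line. -/
theorem ae_isGeneric {a b r : ℝ} (hr : 0 < r) : ∀ᵐ p : ℝ × ℝ, IsGeneric a b r p := by
  have h1 : volume (incidence a b r '' {z | incidenceDet a b r z = 0}) = 0 :=
    addHaar_image_eq_zero_of_det_fderivWithin_eq_zero volume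
      (fun z _ => (hasStrictFDerivAt_incidence a b r z).hasFDerivAt.hasFDerivWithinAt)
      (fun z hz => by rw [det_incidenceDeriv]; exact hz)
  have h2 : volume (incidence a b r '' {z | z.1 = 0}) = 0 := by
    refine addHaar_image_eq_zero_of_differentiableOn_of_addHaar_eq_zero volume
      (fun z _ => (hasStrictFDerivAt_incidence a b r z).hasFDerivAt.differentiableAt
        |>.differentiableWithinAt) ?_
    refine measure_mono_null (fun p hp => ?_) ae_fst_ne_zero
    simpa using hp
  have h1' : ∀ᵐ p : ℝ × ℝ, p ∉ incidence a b r '' {z | incidenceDet a b r z = 0} :=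
    measure_eq_zero_iff_ae_notMem.1 h1
  have h2' : ∀ᵐ p : ℝ × ℝ, p ∉ incidence a b r '' {z | z.1 = 0} :=
    measure_eq_zero_iff_ae_notMem.1 h2
  filter_upwards [h1', h2'] with p hp1 hp2
  refine ⟨fun h => ?_, fun z hz h => hp1 ⟨z, h, hz⟩⟩
  obtain ⟨s, hs⟩ := exists_incidence_eq hr h
  exact hp2 ⟨(0, s), rfl, hs⟩

theorem IsGeneric.simple {a b r : ℝ} (hr : 0 < r) {p : ℝ × ℝ} (hp : IsGeneric a b r p) (t : ℝ)
    (ht : circleEq a b r p t = 0) : circleEqDeriv a b p t ≠ 0 := by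
  obtain ⟨s, hs⟩ := exists_incidence_eq hr ht
  have h := circleEqDeriv_incidence a b r (t, s)
  rw [hs] at h
  rw [h]
  exact mul_ne_zero (by norm_num) (hp.2 _ hs)

/-- The regular part of a fundamental domain for the parameters of the incidence map. -/
def regularParams (a b r : ℝ) : Set (ℝ × ℝ) :=
  Ico 0 (2 * Real.pi) ×ˢ Ico 0 (2 * Real.pi) ∩ {z | incidenceDet a b r z ≠ 0}

theorem measurableSet_regularParams (a b r : ℝ) : MeasurableSet (regularParams a b r) :=
  (measurableSet_Ico.prod measurableSet_Ico).inter
    (isOpen_ne_fun (continuous_incidenceDet a b r) continuous_const).measurableSet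

/-- The number of intersection points, without multiplicities and contacts. -/
def fiberCount (a b r : ℝ) (p : ℝ × ℝ) : ENNReal :=
  Measure.count (regularParams a b r ∩ incidence a b r ⁻¹' {p})

/-- An intersection parameter t determines the angle s modulo 2π, and for generic `p` no point of
the fibre is critical, so projection to t is a bijection. -/
theorem IsGeneric.fiberCount_eq {a b r : ℝ} (hr : 0 < r) {p : ℝ × ℝ} (hp : IsGeneric a b r p) :
    fiberCount a b r p = ((zeroParams a b r p).encard : ENNReal) := by
  have hmeas : MeasurableSet (regularParams a b r ∩ incidence a b r ⁻¹' {p}) := by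
    refine (measurableSet_regularParams a b r).inter (measurableSet_preimage ?_
      (measurableSet_singleton p))
    exact (continuous_iff_continuousAt.2 fun z =>
      (hasStrictFDerivAt_incidence a b r z).hasFDerivAt.continuousAt).measurable
  rw [fiberCount, Measure.count_apply hmeas]
  congr 1
  have hinj : InjOn Prod.fst (regularParams a b r ∩ incidence a b r ⁻¹' {p}) := by
    rintro ⟨t, s⟩ ⟨⟨hz, -⟩, hzp⟩ ⟨t', s'⟩ ⟨⟨hz', -⟩, hzp'⟩ h
    simp only at h
    subst h
    have e : incidence a b r (t, s) = incidence a b r (t, s') := hzp.trans hzp'.symm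
    simp only [incidence, Prod.mk.injEq, add_right_inj] at e
    exact Prod.ext rfl (eq_of_cos_eq_of_sin_eq hz.2 hz'.2 (mul_left_cancel₀ hr.ne' e.1)
      (mul_left_cancel₀ hr.ne' e.2))
  rw [← hinj.encard_image]
  congr 1
  ext t
  constructor
  · rintro ⟨z, ⟨⟨hz, -⟩, hzp⟩, rfl⟩
    refine ⟨hz.1, ?_⟩
    have := circleEq_incidence a b r z
    rwa [show incidence a b r z = p from hzp] at this
  · rintro ⟨ht, h⟩
    obtain ⟨s, hs⟩ := exists_incidence_eq hr h
    obtain ⟨s', hs', hc, hsin⟩ := exists_mem_Ico_cos_sin s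
    have hs2 : incidence a b r (t, s') = p := by
      rw [← hs]
      simp only [incidence, hc, hsin]
    exact ⟨(t, s'), ⟨⟨⟨ht, hs'⟩, hp.2 _ hs2⟩, hs2⟩, rfl⟩

/-! ### The integral of the number of intersection points -/

theorem setLIntegral_Ico_ofReal {f : ℝ → ℝ} (hf : Continuous f) (h0 : ∀ x, 0 ≤ f x) :
    ∫⁻ x in Ico 0 (2 * Real.pi), ENNReal.ofReal (f x) =
      ENNReal.ofReal (∫ x in (0 : ℝ)..2 * Real.pi, f x) := by
  rw [← ofReal_integral_eq_lintegral_ofReal, intervalIntegral.integral_of_le Real.two_pi_pos.le,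
    integral_Ico_eq_integral_Ioo, integral_Ioc_eq_integral_Ioo]
  · exact hf.integrableOn_Icc.mono_set Ico_subset_Icc_self
  · exact Eventually.of_forall h0

theorem integral_abs_cos : ∫ s in (0 : ℝ)..2 * Real.pi, |Real.cos s| = 4 := by
  have hp : Function.Periodic (fun s => |Real.cos s|) Real.pi := fun s => by
    simp [Real.cos_add_pi]
  have hc : ∀ u v : ℝ, IntervalIntegrable (fun s => |Real.cos s|) volume u v := fun u v =>
    Real.continuous_cos.abs.intervalIntegrable u v
  have h : ∀ t, ∫ s in t..t + Real.pi, |Real.cos s| = 2 := by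
    intro t
    rw [hp.intervalIntegral_add_eq t (-(Real.pi / 2))]
    have : ∫ s in -(Real.pi / 2)..-(Real.pi / 2) + Real.pi, |Real.cos s| =
        ∫ s in -(Real.pi / 2)..-(Real.pi / 2) + Real.pi, Real.cos s := by
      refine intervalIntegral.integral_congr fun s hs => ?_
      rw [uIcc_of_le (by linarith [Real.pi_pos])] at hs
      exact abs_of_nonneg (Real.cos_nonneg_of_mem_Icc ⟨hs.1, by linarith [hs.2]⟩)
    rw [this, integral_cos, show -(Real.pi / 2) + Real.pi = Real.pi / 2 by ring]
    simp
    norm_num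
  have e0 := h 0
  have e1 := h Real.pi
  rw [zero_add] at e0
  rw [show 2 * Real.pi = Real.pi + Real.pi by ring,
    ← intervalIntegral.integral_add_adjacent_intervals (hc 0 Real.pi) (hc _ _), e0, e1]
  norm_num

/-- The integrand is a shifted |cos| of amplitude √(A² + B²), and the shift is irrelevant over a
full period. -/
theorem integral_abs_linear_cos_sin (A B : ℝ) :
    ∫ s in (0 : ℝ)..2 * Real.pi, |A * Real.sin s - B * Real.cos s| =
      4 * Real.sqrt (A ^ 2 + B ^ 2) := by
  obtain ⟨R, δ, hR, h1, h2⟩ := exists_polar (-B) A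
  have hB : B = -(R * Real.cos δ) := by linarith
  have e : ∀ s, |A * Real.sin s - B * Real.cos s| = R * |Real.cos (s - δ)| := by
    intro s
    rw [show R * |Real.cos (s - δ)| = |R * Real.cos (s - δ)| by rw [abs_mul, abs_of_nonneg hR], Real.cos_sub, h2, hB]
    congr 1
    ring
  have hsq : A ^ 2 + B ^ 2 = R ^ 2 := by
    rw [h2, hB]
    linear_combination R ^ 2 * Real.sin_sq_add_cos_sq δ
  have hp : Function.Periodic (fun s => |Real.cos s|) (2 * Real.pi) := fun s => by simp
  simp only [e]
  rw [hsq, Real.sqrt_sq hR, intervalIntegral.integral_const_mul,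
    intervalIntegral.integral_comp_sub_right (fun s => |Real.cos s|),
    show 2 * Real.pi - δ = 0 - δ + 2 * Real.pi by ring, hp.intervalIntegral_add_eq _ 0, zero_add,
    integral_abs_cos, mul_comm]

theorem integral_supp_period (a b : ℝ) :
    ∫ t in (0 : ℝ)..2 * Real.pi, supp a b (t + Real.pi / 2) =
      4 * ∫ t in (0 : ℝ)..Real.pi / 2, supp a b t := by
  have hc : ∀ u v : ℝ, IntervalIntegrable (supp a b) volume u v := fun u v =>
    (continuous_supp a b).intervalIntegrable u v
  have hp : Function.Periodic (supp a b) Real.pi := supp_add_pi a b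
  have h1 : ∫ t in (Real.pi / 2)..Real.pi, supp a b t = ∫ t in (0 : ℝ)..Real.pi / 2, supp a b t := by
    have := intervalIntegral.integral_comp_sub_left (a := 0) (b := Real.pi / 2) (supp a b) Real.pi
    rw [show Real.pi - Real.pi / 2 = Real.pi / 2 by ring, sub_zero] at this
    rw [← this]
    simp only [supp_pi_sub]
  have h2 : ∫ t in (0 : ℝ)..Real.pi, supp a b t = 2 * ∫ t in (0 : ℝ)..Real.pi / 2, supp a b t := by
    rw [← intervalIntegral.integral_add_adjacent_intervals (hc 0 (Real.pi / 2)) (hc _ _), h1]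
    ring
  have h3 : ∀ u, ∫ t in u..u + Real.pi, supp a b t =
      2 * ∫ t in (0 : ℝ)..Real.pi / 2, supp a b t := fun u => by
    rw [hp.intervalIntegral_add_eq u 0, zero_add, h2]
  rw [intervalIntegral.integral_comp_add_right (supp a b),
    ← intervalIntegral.integral_add_adjacent_intervals (hc _ (0 + Real.pi / 2 + Real.pi)) (hc _ _),
    h3, show 2 * Real.pi + Real.pi / 2 = 0 + Real.pi / 2 + Real.pi + Real.pi by ring, h3]
  ring

/-- Poincaré's formula for translations. For fixed t the integral of |det| over s is 4r times the
speed h(t + π/2) of the ellipse; integration over t gives 4r times its perimeter 4aE. -/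
theorem lintegral_fiberCount {a b r : ℝ} (hb : 0 < b) (hab : b ≤ a) (hr : 0 < r) :
    Measurable (fiberCount a b r) ∧ ∫⁻ p, fiberCount a b r p =
      ENNReal.ofReal (16 * r * a * completeE (ecc a b)) := by
  have A := lintegral_abs_det_eq_lintegral_count (volume : Measure (ℝ × ℝ))
    (measurableSet_regularParams a b r)
    (fun z _ => hasStrictFDerivAt_incidence a b r z)
    (fun z hz => by rw [det_incidenceDeriv]; exact hz.2)
  refine ⟨A.1, ?_⟩
  change ∫⁻ p, Measure.count (regularParams a b r ∩ incidence a b r ⁻¹' {p}) = _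
  rw [← A.2]
  simp only [det_incidenceDeriv]
  -- Critical parameters contribute nothing, because the integrand vanishes there.
  have hbox : ∫⁻ z in regularParams a b r, ENNReal.ofReal |incidenceDet a b r z| =
      ∫⁻ z in Ico 0 (2 * Real.pi) ×ˢ Ico 0 (2 * Real.pi),
        ENNReal.ofReal |incidenceDet a b r z| := by
    rw [← lintegral_indicator (measurableSet_regularParams a b r),
      ← lintegral_indicator (measurableSet_Ico.prod measurableSet_Ico)]
    refine lintegral_congr fun z => ?_
    by_cases h : incidenceDet a b r z = 0
    · simp only [indicator, h, abs_zero, ENNReal.ofReal_zero, ite_self]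
    · simp only [indicator, regularParams, mem_inter_iff, mem_ofPred_eq, ne_eq, h,
        not_false_eq_true, and_true]
  have hinner : ∀ t, ∫⁻ s in Ico 0 (2 * Real.pi), ENNReal.ofReal |incidenceDet a b r (t, s)| =
      ENNReal.ofReal (4 * r * supp a b (t + Real.pi / 2)) := by
    intro t
    rw [setLIntegral_Ico_ofReal (f := fun s => |incidenceDet a b r (t, s)|)
      (((continuous_incidenceDet a b r).comp (Continuous.prodMk_right t)).abs)
      fun s => abs_nonneg _]
    simp only [incidenceDet, abs_mul, abs_of_pos hr]
    rw [intervalIntegral.integral_const_mul, integral_abs_linear_cos_sin, supp,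
      Real.cos_add_pi_div_two, Real.sin_add_pi_div_two]
    congr 1
    rw [show (b * Real.cos t) ^ 2 + (a * Real.sin t) ^ 2 =
      a ^ 2 * (-Real.sin t) ^ 2 + b ^ 2 * Real.cos t ^ 2 by ring]
    ring
  have hm : Measurable fun z => ENNReal.ofReal |incidenceDet a b r z| :=
    (continuous_incidenceDet a b r).abs.measurable.ennreal_ofReal
  rw [hbox, Measure.volume_eq_prod, ← Measure.prod_restrict, lintegral_prod _ hm.aemeasurable]
  simp only [hinner]
  rw [setLIntegral_Ico_ofReal (f := fun t => 4 * r * supp a b (t + Real.pi / 2)),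
    intervalIntegral.integral_const_mul, integral_supp_period, ← mul_ellipticE hb hab, completeE]
  · congr 1
    ring
  · have := continuous_supp a b
    fun_prop
  · intro t
    have := supp_nonneg a b (t + Real.pi / 2)
    positivity

/-! ### Positions with two and with four intersection points -/

section Positions

variable {a b r : ℝ}

theorem circleIn_subset_regionsMeet : circleIn a b r ⊆ regionsMeet a b r := by
  intro p hp
  refine ⟨(p.1 + r, p.2), ?_, ?_⟩
  · simpa using hp 0
  · simp

theorem ellipseIn_subset_regionsMeet (ha : 0 < a) : ellipseIn a b r ⊆ regionsMeet a b r := by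
  intro p hp
  refine ⟨(a, 0), ?_, ?_⟩
  · simp [ha.ne']
  · simpa using hp 0

/-- If one curve lay inside the region of the other, a common point would be an extremum of the
defining function of one curve along the other, hence a contact, which genericity excludes. -/
theorem mem_of_circleEq_eq_zero (hb : 0 < b) (hab : b ≤ a) (hr : 0 < r) {p : ℝ × ℝ}
    (hp : IsGeneric a b r p) {t : ℝ} (ht : circleEq a b r p t = 0) :
    p ∈ regionsMeet a b r \ (circleIn a b r ∪ ellipseIn a b r) := by
  have ha : 0 < a := hb.trans_le hab
  refine ⟨⟨(a * Real.cos t, b * Real.sin t), ?_, ?_⟩, ?_⟩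
  · simp only [mul_div_cancel_left₀ _ ha.ne', mul_div_cancel_left₀ _ hb.ne',
      Real.cos_sq_add_sin_sq, le_refl]
  · rw [circleEq] at ht
    simp only
    linarith
  rintro (h | h)
  · obtain ⟨s, rfl⟩ := exists_incidence_eq hr ht
    set p := incidence a b r (t, s) with hpdef
    set f : ℝ → ℝ := fun s => ((p.1 + r * Real.cos s) / a) ^ 2 + ((p.2 + r * Real.sin s) / b) ^ 2
      with hf
    -- The angle s points from the ellipse point to the centre of the circle, so the ellipse point
    -- is seen from the centre at angle s + π.
    have hval : f (s + Real.pi) = 1 := by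
      simp only [hf, hpdef, incidence, Real.cos_add_pi, Real.sin_add_pi]
      field_simp
      linear_combination a ^ 2 * b ^ 2 * Real.sin_sq_add_cos_sq t
    have hmax : IsLocalMax f (s + Real.pi) := by
      refine Eventually.of_forall fun x => ?_
      rw [hval]
      exact h x
    have hder : HasDerivAt f (2 / (a * b) * incidenceDet a b r (t, s)) (s + Real.pi) := by
      refine ((((((Real.hasDerivAt_cos (s + Real.pi)).const_mul r).const_add p.1).div_const a).pow
        2).add (((((Real.hasDerivAt_sin (s + Real.pi)).const_mul r).const_add p.2).div_const
        b).pow 2)).congr_deriv ?_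
      simp only [hpdef, incidence, incidenceDet, Real.cos_add_pi, Real.sin_add_pi]
      norm_num
      field_simp
      ring
    have := hmax.hasDerivAt_eq_zero hder
    refine hp.2 (t, s) rfl ?_
    have hne : 2 / (a * b) ≠ 0 := by positivity
    exact (mul_eq_zero.1 this).resolve_left hne
  · have hmax : IsLocalMax (circleEq a b r p) t := by
      refine Eventually.of_forall fun x => ?_
      rw [ht]
      have := h x
      rw [circleEq]
      linarith
    exact hp.simple hr t ht (hmax.hasDerivAt_eq_zero (hasDerivAt_circleEq a b r p t))

theorem pos_or_neg_of_continuous {f : ℝ → ℝ} (hf : Continuous f) (h : ∀ x, f x ≠ 0) :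
    (∀ x, 0 < f x) ∨ ∀ x, f x < 0 := by
  by_contra! hh
  obtain ⟨⟨x, hx⟩, y, hy⟩ := hh
  obtain ⟨z, hz⟩ := mem_range_of_exists_le_of_exists_ge hf ⟨x, hx⟩ ⟨y, hy⟩
  exact h z hz

/-- Without common points the circle equation has constant sign on the ellipse. If it is negative,
the ellipse lies in the disk. If it is positive, no point of the disk is on the ellipse; were some
circle point outside the ellipse, the segment to it from a common point of the regions would stay in
the disk and cross the ellipse. -/
theorem mem_circleIn_or_mem_ellipseIn (hb : 0 < b) (hab : b ≤ a) {p : ℝ × ℝ}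
    (h : ∀ t, circleEq a b r p t ≠ 0) (hp : p ∈ regionsMeet a b r) :
    p ∈ circleIn a b r ∪ ellipseIn a b r := by
  have ha : 0 < a := hb.trans_le hab
  rcases pos_or_neg_of_continuous (continuous_circleEq a b r p) h with hg | hg
  · left
    have hform : ∀ x y : ℝ, (x - p.1) ^ 2 + (y - p.2) ^ 2 ≤ r ^ 2 →
        (x / a) ^ 2 + (y / b) ^ 2 ≠ 1 := by
      intro x y hxy he
      obtain ⟨t, h1, h2⟩ := exists_cos_sin he
      have := hg t
      rw [circleEq, ← h1, ← h2, mul_div_cancel₀ _ ha.ne', mul_div_cancel₀ _ hb.ne'] at this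
      linarith
    obtain ⟨q, hq1, hq2⟩ := hp
    intro s
    by_contra! hs
    set x := p.1 + r * Real.cos s with hx
    set y := p.2 + r * Real.sin s with hy
    have hxy : (x - p.1) ^ 2 + (y - p.2) ^ 2 ≤ r ^ 2 := by
      rw [hx, hy]
      refine le_of_eq ?_
      linear_combination r ^ 2 * Real.sin_sq_add_cos_sq s
    obtain ⟨l, hl, he⟩ : (1 : ℝ) ∈ (fun l : ℝ => ((q.1 + l * (x - q.1)) / a) ^ 2 +
        ((q.2 + l * (y - q.2)) / b) ^ 2) '' Icc 0 1 := by
      refine intermediate_value_Icc zero_le_one (by fun_prop) ⟨?_, ?_⟩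
      · simpa using hq1
      · simpa using hs.le
    refine hform _ _ ?_ he
    have e : (q.1 + l * (x - q.1) - p.1) ^ 2 + (q.2 + l * (y - q.2) - p.2) ^ 2 =
        (1 - l) * ((q.1 - p.1) ^ 2 + (q.2 - p.2) ^ 2) + l * ((x - p.1) ^ 2 + (y - p.2) ^ 2)
          - l * (1 - l) * ((x - q.1) ^ 2 + (y - q.2) ^ 2) := by ring
    rw [e]
    have k1 := mul_le_mul_of_nonneg_left hq2 (sub_nonneg.2 hl.2)
    have k2 := mul_le_mul_of_nonneg_left hxy hl.1
    have k3 := mul_nonneg (mul_nonneg hl.1 (sub_nonneg.2 hl.2))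
      (add_nonneg (sq_nonneg (x - q.1)) (sq_nonneg (y - q.2)))
    linarith
  · right
    intro t
    have := hg t
    rw [circleEq] at this
    linarith

theorem IsGeneric.encard_ne_zero_iff (hb : 0 < b) (hab : b ≤ a) (hr : 0 < r) {p : ℝ × ℝ}
    (hp : IsGeneric a b r p) : (zeroParams a b r p).encard ≠ 0 ↔
      p ∈ regionsMeet a b r \ (circleIn a b r ∪ ellipseIn a b r) := by
  rw [encard_ne_zero]
  constructor
  · rintro ⟨t, -, ht⟩
    exact mem_of_circleEq_eq_zero hb hab hr hp ht
  · rintro ⟨h1, h2⟩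
    by_contra hne
    refine h2 (mem_circleIn_or_mem_ellipseIn hb hab (fun t ht => hne ?_) h1)
    obtain ⟨t', ht', hc, hs⟩ := exists_mem_Ico_cos_sin t
    refine ⟨t', ht', ?_⟩
    rw [circleEq, hc, hs, ← circleEq]
    exact ht

/-- One of the two removed sets is null, so their areas add although disjointness is not assumed. -/
theorem hasCoordArea_diff {R C E : Set (ℝ × ℝ)} {x y z : ℝ} (hR : HasCoordArea R x)
    (hC : HasCoordArea C y) (hE : HasCoordArea E z) (hCR : C ⊆ R) (hER : E ⊆ R)
    (h : y = 0 ∨ z = 0) : HasCoordArea (R \ (C ∪ E)) (x - (y + z)) := by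
  obtain ⟨R1, R2, R3⟩ := hR
  obtain ⟨C1, C2, C3⟩ := hC
  obtain ⟨E1, E2, E3⟩ := hE
  have hd : AEDisjoint volume C E := by
    rcases h with h | h
    · rw [h, ENNReal.toReal_eq_zero_iff, or_iff_left C2] at C3
      exact measure_mono_null inter_subset_left C3
    · rw [h, ENNReal.toReal_eq_zero_iff, or_iff_left E2] at E3
      exact measure_mono_null inter_subset_right E3
  have hu : volume (C ∪ E) = volume C + volume E := measure_union₀ E1 hd
  have hut : volume (C ∪ E) ≠ ⊤ := by
    rw [hu]
    exact ENNReal.add_ne_top.2 ⟨C2, E2⟩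
  refine ⟨R1.diff (C1.union E1), measure_ne_top_of_subset sdiff_subset R2, ?_⟩
  rw [measure_sdiff (union_subset hCR hER) (C1.union E1) hut,
    ENNReal.toReal_sub_of_le (measure_mono (union_subset hCR hER)) R2, hu,
    ENNReal.toReal_add C2 E2, R3, C3, E3]

/-- Two linear equations for two areas: their sum is the area of the positions where the regions
meet without inclusion, and their weighted sum is the integral of the intersection number. -/
theorem hasCoordArea_zeroCount (hb : 0 < b) (hab : b ≤ a) (hr : 0 < r) {A₁ A₂ : ℝ}
    (h1 : HasCoordArea (circleIn a b r) A₁) (h2 : HasCoordArea (ellipseIn a b r) A₂)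
    (h : A₁ = 0 ∨ A₂ = 0) :
    HasCoordArea {p | zeroCount a b r p = 2}
        (2 * Real.pi * r ^ 2 + 2 * Real.pi * a * b - 2 * (A₁ + A₂)) ∧
      HasCoordArea {p | zeroCount a b r p = 4} (A₁ + A₂ - Astar a b r) := by
  have ha : 0 < a := hb.trans_le hab
  obtain ⟨-, M2, M3⟩ := hasCoordArea_diff (hasCoordArea_regionsMeet hb hab hr) h1 h2
    circleIn_subset_regionsMeet (ellipseIn_subset_regionsMeet ha) h
  obtain ⟨hmeas, hint⟩ := lintegral_fiberCount hb hab hr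
  set M := regionsMeet a b r \ (circleIn a b r ∪ ellipseIn a b r) with hM
  set N₂ : Set (ℝ × ℝ) := fiberCount a b r ⁻¹' {2} with hN₂
  set N₄ : Set (ℝ × ℝ) := fiberCount a b r ⁻¹' {4} with hN₄
  have m₂ : MeasurableSet N₂ := hmeas (measurableSet_singleton 2)
  have m₄ : MeasurableSet N₄ := hmeas (measurableSet_singleton 4)
  have h24 : (2 : ENNReal) ≠ 4 := by norm_num
  have hdisj : Disjoint N₂ N₄ := by
    refine disjoint_left.2 fun p hp hp' => h24 ?_
    exact (show fiberCount a b r p = 2 from hp).symm.trans hp'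
  have hae : ∀ᵐ p : ℝ × ℝ, (zeroCount a b r p = 2 ↔ p ∈ N₂) ∧ (zeroCount a b r p = 4 ↔ p ∈ N₄) ∧
      (p ∈ M ↔ p ∈ N₂ ∪ N₄) ∧
      fiberCount a b r p = N₂.indicator (fun _ => 2) p + N₄.indicator (fun _ => 4) p := by
    filter_upwards [ae_isGeneric (a := a) (b := b) hr] with p hp
    have e1 := hp.fiberCount_eq hr
    have e2 := zeroCount_eq_encard (hp.simple hr)
    have e3 := hp.encard_ne_zero_iff hb hab hr
    rw [← hM] at e3
    simp only [indicator, hN₂, hN₄, mem_preimage, mem_singleton_iff, mem_union, e1, e2, ← e3]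
    rcases encard_zeroParams hp.1 (hp.simple hr) with h | h | h <;> simp [h]
  have a₂ : {p | zeroCount a b r p = 2} =ᵐ[volume] N₂ := by
    filter_upwards [hae] with p hp
    exact propext hp.1
  have a₄ : {p | zeroCount a b r p = 4} =ᵐ[volume] N₄ := by
    filter_upwards [hae] with p hp
    exact propext hp.2.1
  have aM : M =ᵐ[volume] (N₂ ∪ N₄ : Set (ℝ × ℝ)) := by
    filter_upwards [hae] with p hp
    exact propext hp.2.2.1
  have hJ : ENNReal.ofReal (16 * r * a * completeE (ecc a b)) =
      2 * volume N₂ + 4 * volume N₄ := by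
    rw [← hint, lintegral_congr_ae (hae.mono fun p hp => hp.2.2.2),
      lintegral_add_left (measurable_const.indicator m₂), lintegral_indicator_const m₂,
      lintegral_indicator_const m₄]
  have hV : volume M = volume N₂ + volume N₄ := by
    rw [measure_congr aM, measure_union hdisj m₄]
  have t₂ : volume N₂ ≠ ⊤ := fun ht => M2 (by rw [hV, ht, top_add])
  have t₄ : volume N₄ ≠ ⊤ := fun ht => M2 (by rw [hV, ht, add_top])
  have hE : 0 ≤ 16 * r * a * completeE (ecc a b) := by
    have : 0 ≤ completeE (ecc a b) :=
      intervalIntegral.integral_nonneg (by positivity) fun _ _ => Real.sqrt_nonneg _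
    positivity
  have hJ' : 16 * r * a * completeE (ecc a b) =
      2 * (volume N₂).toReal + 4 * (volume N₄).toReal := by
    rw [← ENNReal.toReal_ofReal hE, hJ, ENNReal.toReal_add (ENNReal.mul_ne_top (by simp) t₂)
      (ENNReal.mul_ne_top (by simp) t₄), ENNReal.toReal_mul, ENNReal.toReal_mul]
    simp
  rw [hV, ENNReal.toReal_add t₂ t₄] at M3
  have hA : Astar a b (-r) = Real.pi * r ^ 2 + Real.pi * a * b + 4 * r * a * completeE (ecc a b) := by
    rw [Astar]
    ring
  rw [hA] at M3
  refine ⟨⟨m₂.nullMeasurableSet.congr a₂.symm, by rwa [measure_congr a₂], ?_⟩,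
    m₄.nullMeasurableSet.congr a₄.symm, by rwa [measure_congr a₄], ?_⟩
  · rw [measure_congr a₂]
    linarith
  · rw [measure_congr a₄, Astar]
    linarith

end Positions

/-! ### Transfer to the Euclidean plane -/

/-- The frame of the axes of the ellipse. -/
def frame (ψ : ℝ) : Fin 2 → Plane := ![axisDir ψ, axisNormal ψ]

theorem inner_eq_coord (u v : Plane) : inner ℝ u v = u 0 * v 0 + u 1 * v 1 := by
  simp [PiLp.inner_apply, Fin.sum_univ_two, mul_comm]

theorem orthonormal_frame (ψ : ℝ) : Orthonormal ℝ (frame ψ) := by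
  have e := Real.sin_sq_add_cos_sq ψ
  rw [orthonormal_iff_ite]
  intro i j
  rw [inner_eq_coord]
  fin_cases i <;> fin_cases j <;> simp [frame, axisDir, axisNormal] <;> linarith

/-- The orthonormal basis of the plane given by the axes of the ellipse. -/
def frameBasis (ψ : ℝ) : OrthonormalBasis (Fin 2) ℝ Plane :=
  OrthonormalBasis.mk (orthonormal_frame ψ) (by
    rw [(orthonormal_frame ψ).linearIndependent.span_eq_top_of_card_eq_finrank (by simp)])

/-- Coordinates of the centre of the circle relative to the ellipse with centre `m`. -/
def relCoord (ψ : ℝ) (c m : Plane) : ℝ × ℝ :=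
  (inner ℝ (axisDir ψ) (c - m), inner ℝ (axisNormal ψ) (c - m))

/-- The composite of m ↦ c - m, an orthonormal change of basis and the identification of the plane
with ℝ × ℝ. -/
theorem measurePreserving_relCoord (ψ : ℝ) (c : Plane) :
    MeasurePreserving (relCoord ψ c) volume volume := by
  have h := (volume_preserving_finTwoArrow ℝ).comp
    ((EuclideanSpace.volume_preserving_symm_measurableEquiv_toLp (Fin 2)).comp
      ((frameBasis ψ).measurePreserving_repr.comp (Measure.measurePreserving_sub_left volume c)))
  convert h using 1
  funext m
  refine Prod.ext ?_ ?_
  · change _ = (frameBasis ψ).repr (c - m) 0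
    simp [OrthonormalBasis.repr_apply_apply, frameBasis, frame, relCoord, inner_sub_right]
  · change _ = (frameBasis ψ).repr (c - m) 1
    simp [OrthonormalBasis.repr_apply_apply, frameBasis, frame, relCoord, inner_sub_right]

theorem HasCoordArea.hasArea {S : Set (ℝ × ℝ)} {x : ℝ} (h : HasCoordArea S x) (ψ : ℝ) (c : Plane) :
    HasArea (relCoord ψ c ⁻¹' S) x := by
  have hT := measurePreserving_relCoord ψ c
  have e := hT.measure_preimage h.1
  exact ⟨h.1.preimage hT.quasiMeasurePreserving, by rw [e]; exact h.2.1, by rw [e]; exact h.2.2⟩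

theorem norm_sq_eq_frame (ψ : ℝ) (v : Plane) :
    ‖v‖ ^ 2 = inner ℝ (axisDir ψ) v ^ 2 + inner ℝ (axisNormal ψ) v ^ 2 := by
  rw [inner_eq_coord, inner_eq_coord, EuclideanSpace.norm_sq_eq, Fin.sum_univ_two]
  simp only [Real.norm_eq_abs, sq_abs, axisDir, axisNormal, Matrix.cons_val_zero,
    Matrix.cons_val_one]
  linear_combination (-(v 0 ^ 2 + v 1 ^ 2)) * Real.sin_sq_add_cos_sq ψ

theorem ellipseForm_eq (a b ψ : ℝ) (c m x : Plane) : ellipseForm a b ψ m x =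
    (((relCoord ψ c m).1 + inner ℝ (axisDir ψ) (x - c)) / a) ^ 2 +
      (((relCoord ψ c m).2 + inner ℝ (axisNormal ψ) (x - c)) / b) ^ 2 := by
  rw [ellipseForm, relCoord, ← inner_add_right, ← inner_add_right, sub_add_sub_comm,
    add_comm c x, add_sub_add_right_eq_sub]

theorem pullback_eq_circleEq (a b ψ r : ℝ) (c m : Plane) :
    pullback a b ψ r c m = circleEq a b r (relCoord ψ c m) := by
  funext t
  rw [pullback, circleEq, dist_eq_norm, norm_sq_eq_frame ψ,
    show ellipsePoint a b ψ m t - c = ellipsePoint a b ψ m t - m - (c - m) by abel,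
    inner_sub_right _ _ (c - m), inner_sub_right _ _ (c - m), inner_axisDir_ellipsePoint,
    inner_axisNormal_ellipsePoint]
  rfl

theorem circleInside_eq {a b ψ r : ℝ} (hr : 0 < r) (c : Plane) :
    circleInside a b ψ r c = relCoord ψ c ⁻¹' circleIn a b r := by
  ext m
  constructor
  · intro h s
    have e1 := inner_axisDir_ellipsePoint r r ψ c s
    have e2 := inner_axisNormal_ellipsePoint r r ψ c s
    have hs : ellipsePoint r r ψ c s ∈ Metric.sphere c r := by
      rw [Metric.mem_sphere, dist_eq_norm, ← sq_eq_sq₀ (norm_nonneg _) hr.le, norm_sq_eq_frame ψ, e1, e2]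
      linear_combination r ^ 2 * Real.sin_sq_add_cos_sq s
    have := h hs
    rw [ellipseRegion, mem_ofPred_eq, ellipseForm_eq a b ψ c, e1, e2] at this
    exact this
  · intro h x hx
    rw [Metric.mem_sphere, dist_eq_norm, ← sq_eq_sq₀ (norm_nonneg _) hr.le, norm_sq_eq_frame ψ] at hx
    obtain ⟨s, h1, h2⟩ := exists_cos_sin (x := inner ℝ (axisDir ψ) (x - c) / r)
      (y := inner ℝ (axisNormal ψ) (x - c) / r) (by
        field_simp
        exact hx)
    rw [div_eq_iff hr.ne'] at h1 h2
    have := h s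
    rw [ellipseRegion, mem_ofPred_eq, ellipseForm_eq a b ψ c, h1, h2, mul_comm _ r, mul_comm _ r]
    exact this

theorem dist_ellipsePoint_sq (a b ψ r : ℝ) (c m : Plane) (t : ℝ) :
    dist (ellipsePoint a b ψ m t) c ^ 2 = circleEq a b r (relCoord ψ c m) t + r ^ 2 := by
  rw [← pullback_eq_circleEq, pullback]
  ring

theorem ellipseInside_eq {a b ψ r : ℝ} (ha : 0 < a) (hb : 0 < b) (hr : 0 < r) (c : Plane) :
    ellipseInside a b ψ r c = relCoord ψ c ⁻¹' ellipseIn a b r := by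
  have key : ∀ m t, ellipsePoint a b ψ m t ∈ Metric.closedBall c r ↔
      (a * Real.cos t - (relCoord ψ c m).1) ^ 2 + (b * Real.sin t - (relCoord ψ c m).2) ^ 2 ≤
        r ^ 2 := by
    intro m t
    rw [Metric.mem_closedBall, ← sq_le_sq₀ dist_nonneg hr.le, dist_ellipsePoint_sq a b ψ r,
      circleEq, sub_add_cancel]
  ext m
  constructor
  · intro h t
    refine (key m t).1 (h ?_)
    simp [ellipse, ellipseForm, inner_axisDir_ellipsePoint, inner_axisNormal_ellipsePoint,
      ha.ne', hb.ne']
  · intro h x hx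
    obtain ⟨t, -, rfl⟩ := (bijOn_ellipsePoint ha hb ψ m).surjOn hx
    exact (key m t).2 (h t)

theorem intersectionCount_eq {a b ψ r : ℝ} (hr : 0 < r) (c m : Plane) :
    intersectionCount a b ψ r c m = zeroCount a b r (relCoord ψ c m) := by
  change orderSum (fun t => ellipsePoint a b ψ m t ∈ Metric.sphere c r)
    (pullback a b ψ r c m) = _
  rw [zeroCount, pullback_eq_circleEq]
  congr 1
  funext t
  rw [Metric.mem_sphere, ← sq_eq_sq₀ dist_nonneg hr.le, dist_ellipsePoint_sq a b ψ r,
    add_eq_right]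

theorem hasArea_positions {a b r : ℝ} (ψ : ℝ) (c : Plane) (hb : 0 < b) (hab : b ≤ a) (hr : 0 < r)
    {A₁ A₂ A x₂ x₄ : ℝ} (h1 : HasCoordArea (circleIn a b r) A₁)
    (h2 : HasCoordArea (ellipseIn a b r) A₂) (h : A₁ = 0 ∨ A₂ = 0) (hA : A₁ + A₂ = A)
    (hx₂ : 2 * Real.pi * r ^ 2 + 2 * Real.pi * a * b - 2 * A = x₂)
    (hx₄ : A - Astar a b r = x₄) :
    HasArea (circleInside a b ψ r c) A₁ ∧ HasArea (ellipseInside a b ψ r c) A₂ ∧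
      HasArea (meetsIn 2 a b ψ r c) x₂ ∧ HasArea (meetsIn 4 a b ψ r c) x₄ := by
  obtain ⟨h3, h4⟩ := hasCoordArea_zeroCount hb hab hr h1 h2 h
  have hm : ∀ n : ℕ, meetsIn n a b ψ r c = relCoord ψ c ⁻¹' {p | zeroCount a b r p = n} := by
    intro n
    ext m
    simp only [meetsIn, mem_ofPred_eq, mem_preimage, intersectionCount_eq hr]
  subst hA hx₂ hx₄
  rw [circleInside_eq hr, ellipseInside_eq (hb.trans_le hab) hb hr, hm, hm]
  exact ⟨h1.hasArea ψ c, h2.hasArea ψ c, h3.hasArea ψ c, h4.hasArea ψ c⟩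

end EllipseCircle

end

/-! ### The five ranges of the radius -/

theorem lemma1 (a b r ψ : ℝ) (c : EllipseCircle.Plane) (hb : 0 < b) (hab : b ≤ a) (hr : 0 < r) :
    Tendsto (EllipseCircle.F a b r) (𝓝[<] (Real.pi / 2)) (𝓝 (EllipseCircle.Astar a b r)) ∧
    (r ≤ b ^ 2 / a →
      EllipseCircle.HasArea (EllipseCircle.circleInside a b ψ r c) (EllipseCircle.Astar a b r) ∧
      EllipseCircle.HasArea (EllipseCircle.ellipseInside a b ψ r c) 0 ∧
      EllipseCircle.HasArea (EllipseCircle.meetsIn 2 a b ψ r c)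
        (8 * r * a * EllipseCircle.completeE (EllipseCircle.ecc a b)) ∧
      EllipseCircle.HasArea (EllipseCircle.meetsIn 4 a b ψ r c) 0) ∧
    (b ^ 2 / a < r → r < b →
      EllipseCircle.HasArea (EllipseCircle.circleInside a b ψ r c)
        (EllipseCircle.Ftilde a b r (EllipseCircle.alpha a b r)) ∧
      EllipseCircle.HasArea (EllipseCircle.ellipseInside a b ψ r c) 0 ∧
      EllipseCircle.HasArea (EllipseCircle.meetsIn 2 a b ψ r c)
        (2 * Real.pi * r ^ 2 + 2 * Real.pi * a * b
          - 2 * EllipseCircle.Ftilde a b r (EllipseCircle.alpha a b r)) ∧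
      EllipseCircle.HasArea (EllipseCircle.meetsIn 4 a b ψ r c)
        (EllipseCircle.Ftilde a b r (EllipseCircle.alpha a b r) - EllipseCircle.Astar a b r)) ∧
    (b ≤ r → r ≤ a →
      EllipseCircle.HasArea (EllipseCircle.circleInside a b ψ r c) 0 ∧
      EllipseCircle.HasArea (EllipseCircle.ellipseInside a b ψ r c) 0 ∧
      EllipseCircle.HasArea (EllipseCircle.meetsIn 2 a b ψ r c)
        (2 * Real.pi * r ^ 2 + 2 * Real.pi * a * b) ∧
      EllipseCircle.HasArea (EllipseCircle.meetsIn 4 a b ψ r c) (-EllipseCircle.Astar a b r)) ∧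
    (a < r → r < a ^ 2 / b →
      EllipseCircle.HasArea (EllipseCircle.circleInside a b ψ r c) 0 ∧
      EllipseCircle.HasArea (EllipseCircle.ellipseInside a b ψ r c)
        (EllipseCircle.F a b r (EllipseCircle.beta a b r)) ∧
      EllipseCircle.HasArea (EllipseCircle.meetsIn 2 a b ψ r c)
        (2 * Real.pi * r ^ 2 + 2 * Real.pi * a * b
          - 2 * EllipseCircle.F a b r (EllipseCircle.beta a b r)) ∧
      EllipseCircle.HasArea (EllipseCircle.meetsIn 4 a b ψ r c)
        (EllipseCircle.F a b r (EllipseCircle.beta a b r) - EllipseCircle.Astar a b r)) ∧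
    (a ^ 2 / b ≤ r →
      EllipseCircle.HasArea (EllipseCircle.circleInside a b ψ r c) 0 ∧
      EllipseCircle.HasArea (EllipseCircle.ellipseInside a b ψ r c) (EllipseCircle.Astar a b r) ∧
      EllipseCircle.HasArea (EllipseCircle.meetsIn 2 a b ψ r c)
        (8 * r * a * EllipseCircle.completeE (EllipseCircle.ecc a b)) ∧
      EllipseCircle.HasArea (EllipseCircle.meetsIn 4 a b ψ r c) 0) := by
  have ha : 0 < a := hb.trans_le hab
  have h8 : 2 * Real.pi * r ^ 2 + 2 * Real.pi * a * b - 2 * EllipseCircle.Astar a b r =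
      8 * r * a * EllipseCircle.completeE (EllipseCircle.ecc a b) := by
    rw [EllipseCircle.Astar]
    ring
  have hba : b ^ 2 / a ≤ b := by
    rw [div_le_iff₀ ha]
    nlinarith
  have hab' : a ≤ a ^ 2 / b := by
    rw [le_div_iff₀ hb]
    nlinarith
  refine ⟨EllipseCircle.tendsto_F_pi_div_two hb hab r, fun h => ?_, fun h h' => ?_, fun h h' => ?_,
    fun h h' => ?_, fun h => ?_⟩
  · exact EllipseCircle.hasArea_positions ψ c hb hab hr
      (EllipseCircle.hasCoordArea_circleIn_of_le_div hb hab hr h)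
      (EllipseCircle.hasCoordArea_ellipseIn_of_le hb hab hr (h.trans (hba.trans hab)))
      (Or.inr rfl) (add_zero _) h8 (sub_self _)
  · exact EllipseCircle.hasArea_positions ψ c hb hab hr
      (EllipseCircle.hasCoordArea_circleIn_of_lt hb hab h h')
      (EllipseCircle.hasCoordArea_ellipseIn_of_le hb hab hr (h'.le.trans hab))
      (Or.inr rfl) (add_zero _) rfl rfl
  · exact EllipseCircle.hasArea_positions ψ c hb hab hr
      (EllipseCircle.hasCoordArea_circleIn_of_le hb hab hr h)
      (EllipseCircle.hasCoordArea_ellipseIn_of_le hb hab hr h')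
      (Or.inr rfl) (add_zero _) (by ring) (zero_sub _)
  · exact EllipseCircle.hasArea_positions ψ c hb hab hr
      (EllipseCircle.hasCoordArea_circleIn_of_le hb hab hr (hab.trans h.le))
      (EllipseCircle.hasCoordArea_ellipseIn_of_lt hb hab h h')
      (Or.inl rfl) (zero_add _) rfl rfl
  · exact EllipseCircle.hasArea_positions ψ c hb hab hr
      (EllipseCircle.hasCoordArea_circleIn_of_le hb hab hr (hab.trans (hab'.trans h)))
      (EllipseCircle.hasCoordArea_ellipseIn_of_div_le hb hab h)
      (Or.inl rfl) (zero_add _) h8 (sub_self _)
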